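/- Setting. Let $d\ge 1$, and give $\mathbb Z^d$ the componentwise order; $\bigvee$ and $\bigwedge$ are componentwise join and meet. Let $\Phi$ be a finite gain graph with gain group $\mathbb Z^d$: a finite graph with vertices $v_1,\dots,v_n$ (loops, parallel edges and half edges allowed) in which each loop or link $e$, oriented from $v_i$ to $v_j$, has a gain $\phi(e)\in\mathbb Z^d$, the opposite orientation having gain $-\phi(e)$. The gain of a path or circle is the sum of the gains of its edges (oriented along it). Assume that $\Phi$ has no loops of gain $0$ and no loose edges (edges without endpoints). For each $i$ let $H_i\subseteq\mathbb Z^d$ be a list of the form $\{x: x\ge a\}\setminus A$ with $a\in\mathbb Z^d$ and $A$ a finite subset of $\{x: x\ge a\}$. Put $h_i:=\bigwedge H_i$, $\bar H_i:=\{x: x\ge h_i\}\setminus H_i$ (a finite set), and $\hat h_i:=\bigvee\bar H_i$, or $\hat h_i:=h_i-(1,\dots,1)$ if $\bar H_i=\varnothing$. The list chromatic function $\chi(m)$, for $m=(m_1,\dots,m_n)\in(\mathbb Z^d)^n$, is the number of $x=(x_1,\dots,x_n)\in(\mathbb Z^d)^n$ with $x_i\in H_i$ and $x_i\le m_i$ for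 all $i$, and $x_j\ne x_i+\phi(e)$ for every loop or link $e$ from $v_i$ to $v_j$. An edge set $B$ is balanced if it has no half edges and all its circles have gain $0$; a balanced $B$ is closed if it contains every edge whose endpoints are joined by a path in $B$ with the same gain. Let $L$ be the poset of closed balanced edge sets, ordered by inclusion, with Möbius function $\mu$. Let $\pi(B)$ be the partition of the vertex set into the vertex sets of the components of $B$, and let $\eta_B$ be the top switching function of $B$: the function from the vertices to $\mathbb Z^d$ with $-\eta_B(v_i)+\phi(e)+\eta_B(v_j)=0$ for every edge $e$ of $B$ from $v_i$ to $v_j$ and $\bigwedge_{v\in W}\eta_B(v)=0$ for every $W\in\pi(B)$. For $B\in L$, $W\in\pi(B)$, $1\le k\le d$ and real variables $m_{ik}$ define $$q_k(B,W):=\min_{v_i\in W}\bigl(m_{ik}+\eta_B(v_i)_k\bigr)-\max_{v_i\in W}\bigl(h_{ik}+\eta_B(v_i)_k\bigr)+1,$$ $$S(B,W):=\Bigl\{c\in\bigcup_{v_i\in W}\bigl(\bar H_i+\eta_B(v_i)\bigr): c\ge\bigvee_{v_i\in W}\bigl(h_i+\eta_B(v_i)\bigr)\Bigr\},$$ $$p(m):=\sum_{B\in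 L}\mu(\varnothing,B)\prod_{W\in\pi(B)}\Bigl(\prod_{k=1}^d q_k(B,W)-\bigl|S(B,W)\bigr|\Bigr).$$ Let $\alpha_{ji}$ be the join of the gains of all paths from $v_j$ to $v_i$ (including the path of length $0$ if $i=j$), and let $b_i:=\bigvee_j(\hat h_j+\alpha_{ji})$, over those $j$ for which there is a path from $v_j$ to $v_i$. A function $f:\mathbb R^r\to\mathbb R$ is called a piecewise polynomial with leading term $y_1\cdots y_r$ if $\mathbb R^r$ is the union of finitely many closed full-dimensional sets $D_\sigma$ on each of which $f$ agrees with a polynomial $p_\sigma$, where at least one $p_\sigma$ is $y_1\cdots y_r$ plus terms of lower total degree, and every $p_\sigma$ has degree at most $1$ in each variable. Theorem. The number $\chi(m)$ is finite for every $m\in(\mathbb Z^d)^n$. The function $p$ is a piecewise polynomial in the $nd$ real variables $m_{ik}$ with leading term $\prod_{i=1}^n\prod_{k=1}^d m_{ik}$. The list chromatic function $\chi$ is the restriction to $(\mathbb Z^d)^n$ of a piecewise polynomial on $(\mathbb R^d)^n$ with the same leading term, which may be chosen equal to $p$ at all real points $m$ with $m_i\ge b_i$ for all $i$. In particular, $\chi(m)=p(m)$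 for all $m\in(\mathbb Z^d)^n$ with $m_i\ge b_i$ for all $i$. -/

import Mathlib

/-- The possible edges of a gain graph on the vertex set `V` with (additive) gain group `G`.
`arc u v g` is an ordinary edge (a link if `u ≠ v`, a loop if `u = v`), recorded through one of its
two orientations: its gain is `g` from `u` to `v` and `-g` from `v` to `u`.  A half edge has one
endpoint, a loose edge has none; neither carries a gain. -/
inductive GainEdge (V G : Type*) where
  | arc (u v : V) (g : G)
  | half (v : V)
  | loose

/-- A gain graph with vertex set `V`, edge set `E` and gain group `G`; parallel edges are allowed. -/
structure GainGraph (V E G : Type*) where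
  edge : E → GainEdge V G

namespace GainGraph

section General

variable {V E G : Type*} [AddCommGroup G] (Φ : GainGraph V E G)

/-- The edge `e`, oriented from `u` to `v`, has gain `g`. -/
def Step (e : E) (u v : V) (g : G) : Prop :=
  Φ.edge e = GainEdge.arc u v g ∨ Φ.edge e = GainEdge.arc v u (-g)

/-- `Φ.Walk S u l v g`: the list `l` of pairs (edge, vertex reached through it) is a walk from `u`
to `v` with edges in `S`, and its gain (the sum of the gains of its oriented edges) is `g`. -/
inductive Walk (S : Finset E) : V → List (E × V) → V → G → Prop
  | nil (u : V) : Walk S u [] u 0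
  | cons {e : E} {u v w : V} {g g' : G} {l : List (E × V)} (he : e ∈ S) (hs : Φ.Step e u v g)
      (hw : Walk S v l w g') : Walk S u ((e, v) :: l) w (g + g')

/-- There is an (open) path in `S` from `u` to `v` with gain `g`: a walk without repeated vertex.
The path of length `0` from `u` to `u` has gain `0`. -/
def PathGain (S : Finset E) (u v : V) (g : G) : Prop :=
  ∃ l : List (E × V), Φ.Walk S u l v g ∧ (u :: l.map Prod.snd).Nodup

/-- There is a circle in `S` which, started at `v` and traversed in one of its directions,
has gain `g`: a closed walk of positive length without repeated edge and without repeated vertex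
(other than the first being the last).  A loop is a circle of length `1`. -/
def CircleGain (S : Finset E) (v : V) (g : G) : Prop :=
  ∃ l : List (E × V), l ≠ [] ∧ Φ.Walk S v l v g ∧ (l.map Prod.fst).Nodup ∧ (l.map Prod.snd).Nodup

/-- An edge set is balanced if it has no half edges and all its circles have gain `0`. -/
def Balanced (S : Finset E) : Prop :=
  (∀ e ∈ S, ∀ v, Φ.edge e ≠ GainEdge.half v) ∧ ∀ v g, Φ.CircleGain S v g → g = 0

/-- A balanced edge set `S` is closed if it contains every edge whose endpoints are joined by a path
in `S` with the same gain (loose edges are treated like balanced loops). -/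
def Closed (S : Finset E) : Prop :=
  (∀ e, Φ.edge e = GainEdge.loose → e ∈ S) ∧
    ∀ e u v g, Φ.PathGain S u v g → Φ.Step e u v g → e ∈ S

/-- The semilattice of closed, balanced edge sets, ordered by inclusion. -/
abbrev Latb : Type _ := {B : Finset E // Φ.Balanced B ∧ Φ.Closed B}

open Classical in
/-- The value `μ(∅, B)` of the Möbius function of the poset of closed balanced edge sets;
it is `0` by convention if `∅` is not closed. -/
noncomputable def muEmpty [Fintype E] (B : Φ.Latb) : ℤ :=
  letI : LocallyFiniteOrder Φ.Latb := Fintype.toLocallyFiniteOrder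
  if h : Φ.Balanced ∅ ∧ Φ.Closed ∅ then IncidenceAlgebra.mu ℤ (⟨∅, h⟩ : Φ.Latb) B else 0

open Classical in
/-- The vertex set of the component of `(V, S)` that contains `u`. -/
noncomputable def component [Fintype V] (S : Finset E) (u : V) : Finset V :=
  Finset.univ.filter fun v => ∃ l g, Φ.Walk S u l v g

open Classical in
/-- The partition `π(S)` of `V` into the vertex sets of the components of `(V, S)`. -/
noncomputable def parts [Fintype V] (S : Finset E) : Finset (Finset V) :=
  Finset.univ.image (Φ.component S)

/-- `η` is a top switching function for `S`: the gains of the edges in `S`, switched by `η`,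
are `0`, and in each component of `S` the meet of the values of `η` is `0`. -/
def IsTopSwitching [Fintype V] [PartialOrder G] (S : Finset E) (η : V → G) : Prop :=
  (∀ e ∈ S, ∀ u v g, Φ.Step e u v g → -η u + g + η v = 0) ∧
    ∀ W ∈ Φ.parts S, IsGLB (η '' (W : Set V)) 0

/-- The top switching function `η_S` of a balanced edge set `S`
(an arbitrary function if `S` has no top switching function). -/
noncomputable def topSwitching [Fintype V] [PartialOrder G] (S : Finset E) : V → G :=
  Classical.epsilon (Φ.IsTopSwitching S)

end General

end GainGraph

section Lists

variable {d : ℕ}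

/-- The class `𝔚₂` of vertex lists: (cone) minus (finite set), where the cone with apex `a` is
`Set.Ici a = {x | a ≤ x}` for the componentwise order of `ℤ^d`. -/
def IsConeMinusFinite (H : Set (Fin d → ℤ)) : Prop :=
  ∃ (a : Fin d → ℤ) (A : Set (Fin d → ℤ)), A.Finite ∧ A ⊆ Set.Ici a ∧ H = Set.Ici a \ A

/-- The meet of the members of a list (the infimum is taken componentwise). -/
noncomputable def apex (H : Set (Fin d → ℤ)) : Fin d → ℤ := sInf H

/-- The cone complement of a list: the colors above its apex that do not belong to it. -/
def holes (H : Set (Fin d → ℤ)) : Set (Fin d → ℤ) := Set.Ici (apex H) \ H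

open Classical in
/-- The join of the holes of a list, or its apex minus `(1, …, 1)` if there are no holes. -/
noncomputable def holeTop (H : Set (Fin d → ℤ)) : Fin d → ℤ :=
  if holes H = ∅ then apex H - 1 else sSup (holes H)

end Lists

section Piecewise

variable {ι : Type*}

/-- The function `f` on `ℝ^ι` is the polynomial `P σ` on the set `D σ` for each of the finitely many
indices `σ`, where the `D σ` are closed, full-dimensional (non-empty, and each point is a limit of
interior points) and cover `ℝ^ι`. -/
def HasPieces {N : ℕ} (f : (ι → ℝ) → ℝ) (D : Fin N → Set (ι → ℝ))
    (P : Fin N → MvPolynomial ι ℝ) : Prop :=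
  (∀ σ, IsClosed (D σ) ∧ (D σ).Nonempty ∧ D σ ⊆ closure (interior (D σ))) ∧
    (⋃ σ, D σ) = Set.univ ∧ ∀ σ, ∀ y ∈ D σ, f y = MvPolynomial.eval y (P σ)

/-- The polynomial `P` has leading term `∏ i, y i`: all its other terms have smaller total degree. -/
def IsMonicMultilinear [Fintype ι] (P : MvPolynomial ι ℝ) : Prop :=
  ∀ s ∈ (P - ∏ i, MvPolynomial.X i).support, s.degree < Fintype.card ι

/-- `f` is a piecewise polynomial with leading term `∏ i, y i`: at least one of its polynomials has
that leading term, and all of them have degree at most `1` in each variable. -/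
def IsPiecewisePolynomialWithLeadingProd [Fintype ι] (f : (ι → ℝ) → ℝ) : Prop :=
  ∃ (N : ℕ) (D : Fin N → Set (ι → ℝ)) (P : Fin N → MvPolynomial ι ℝ), HasPieces f D P ∧
    (∃ σ, IsMonicMultilinear (P σ)) ∧ ∀ σ i, (P σ).degreeOf i ≤ 1

end Piecewise

namespace GainGraph

section Lattice

variable {V E : Type*} {d : ℕ} (Φ : GainGraph V E (Fin d → ℤ)) (H : V → Set (Fin d → ℤ))

/-- The proper colorations `x` with `x i` in the list `H i` and `x i ≤ m i` for all `i`. -/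
def properColorations (m : V → Fin d → ℤ) : Set (V → Fin d → ℤ) :=
  {x | (∀ i, x i ∈ H i ∧ x i ≤ m i) ∧ ∀ e i j g, Φ.Step e i j g → x j ≠ x i + g}

/-- The list chromatic function. -/
noncomputable def listChromatic (m : V → Fin d → ℤ) : ℕ := (Φ.properColorations H m).ncard

/-- The join `α_ji(Φ)` of the gains of all paths from `j` to `i` (used only if there is one). -/
noncomputable def alpha [Fintype E] (j i : V) : Fin d → ℤ :=
  sSup {g | Φ.PathGain Finset.univ j i g}

/-- The lower bound for `m i`: the join of `holeTop (H j) + alpha j i` over all `j` from which there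
is a path to `i` (an empty join `alpha j i` imposes no condition). -/
noncomputable def bound [Fintype E] (i : V) : Fin d → ℤ :=
  sSup {z | ∃ j, (∃ g, Φ.PathGain Finset.univ j i g) ∧ z = holeTop (H j) + Φ.alpha j i}

variable [Fintype V]

/-- The function `q_k(B, W)` of the real variables `y (i, k)`; the infimum and the supremum are
a minimum and a maximum over the non-empty finite set `W`. -/
noncomputable def q (B : Finset E) (W : Finset V) (k : Fin d) (y : V × Fin d → ℝ) : ℝ :=
  (⨅ i : W, (y (i, k) + (Φ.topSwitching B i k : ℝ))) -
    (⨆ i : W, ((apex (H i) k : ℝ) + (Φ.topSwitching B i k : ℝ))) + 1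

/-- The switched holes of the lists in `W` that lie in all the switched cones of the lists
in `W`. -/
def switchedHoles (B : Finset E) (W : Finset V) : Set (Fin d → ℤ) :=
  {c | (∃ i ∈ W, ∃ a ∈ holes (H i), c = a + Φ.topSwitching B i) ∧
    ∀ i ∈ W, apex (H i) + Φ.topSwitching B i ≤ c}

open Classical in
/-- The Möbius function sum `p`, as a function of the real variables `y (i, k)`. -/
noncomputable def p [Fintype E] (y : V × Fin d → ℝ) : ℝ :=
  ∑ B : Φ.Latb, (Φ.muEmpty B : ℝ) *
    ∏ W ∈ Φ.parts B.1, ((∏ k, Φ.q H B.1 W k y) - ((Φ.switchedHoles H B.1 W).ncard : ℝ))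

end Lattice

end GainGraph

/-!
Möbius inversion over `L` writes `χ(m)` as the sum over `B ∈ L` of `μ(∅, B)` times the number of
colorations that are improper on all of `B`. Switching by a potential of `B` makes such colorations
constant on the components of `B`, so their number is a product over the components `W`. The factor
of `W` counts the points of a box, the intersection of the switched cones below the meet of the
switched upper bounds, that are not switched holes.

Truncating the sides of the box at `0`, and counting each hole gradually as the upper bounds reach
it, extends this count to a continuous function of real upper bounds that is given at each point by
one of finitely many multiaffine polynomials. Above the bounds `b_i` no truncation is active and the
extension is `p`. Every non-empty `B` has fewer than `n` components, hence contributes lower degree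
than `B = ∅`, which contributes the leading term.

Finally, the closed sets on which a continuous selection `f` agrees with one of its polynomials
cover the space, so by Baire's theorem the closures of their interiors also cover it; these are the
full-dimensional pieces.
-/

namespace GainGraph

section Walks

variable {V E G : Type*} [AddCommGroup G] {Φ : GainGraph V E G} {S : Finset E}

theorem Step.symm {e : E} {u v : V} {g : G} (h : Φ.Step e u v g) : Φ.Step e v u (-g) := by
  rcases h with h | h
  · exact Or.inr (by rwa [neg_neg])
  · exact Or.inl h

theorem Step.eq_or_eq_symm {e : E} {u v u' v' : V} {g g' : G} (h : Φ.Step e u v g)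
    (h' : Φ.Step e u' v' g') : (u = u' ∧ v = v' ∧ g = g') ∨ (u = v' ∧ v = u' ∧ g = -g') := by
  rcases h with h | h <;> rcases h' with h' | h' <;> rw [h] at h' <;>
    simp only [GainEdge.arc.injEq, neg_eq_iff_eq_neg, neg_neg] at h' <;> tauto

theorem exists_step {e : E} (hhalf : ∀ v, Φ.edge e ≠ GainEdge.half v)
    (hloose : Φ.edge e ≠ GainEdge.loose) : ∃ u v g, Φ.Step e u v g := by
  cases he : Φ.edge e with
  | arc u v g => exact ⟨u, v, g, Or.inl he⟩
  | half v => exact absurd he (hhalf v)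
  | loose => exact absurd he hloose

theorem Walk.single {e : E} {u v : V} {g : G} (he : e ∈ S) (hs : Φ.Step e u v g) :
    Φ.Walk S u [(e, v)] v g := by
  simpa only [add_zero] using Walk.cons he hs (Walk.nil v)

theorem Walk.append {l l' : List (E × V)} {u v w : V} {g g' : G} (h : Φ.Walk S u l v g)
    (h' : Φ.Walk S v l' w g') : Φ.Walk S u (l ++ l') w (g + g') := by
  induction h with
  | nil u => simpa only [List.nil_append, zero_add] using h'
  | cons he hs _ ih => simpa only [List.cons_append, add_assoc] using Walk.cons he hs (ih h')

theorem Walk.exists_reverse {l : List (E × V)} {u v : V} {g : G} (h : Φ.Walk S u l v g) :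
    ∃ l', Φ.Walk S v l' u (-g) := by
  induction h with
  | nil u => exact ⟨[], by simpa only [neg_zero] using Walk.nil u⟩
  | cons he hs _ ih =>
    obtain ⟨l', hl'⟩ := ih
    exact ⟨_, by simpa only [neg_add_rev] using hl'.append (Walk.single he hs.symm)⟩

theorem Walk.mono {T : Finset E} (hST : S ⊆ T) {l : List (E × V)} {u v : V} {g : G}
    (h : Φ.Walk S u l v g) : Φ.Walk T u l v g := by
  induction h with
  | nil u => exact Walk.nil u
  | cons he hs _ ih => exact Walk.cons (hST he) hs ih

theorem PathGain.mono {T : Finset E} (hST : S ⊆ T) {u v : V} {g : G}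
    (h : Φ.PathGain S u v g) : Φ.PathGain T u v g :=
  let ⟨l, hw, hn⟩ := h
  ⟨l, hw.mono hST, hn⟩

theorem Walk.end_mem {l : List (E × V)} {u v : V} {g : G} (h : Φ.Walk S u l v g) :
    v ∈ u :: l.map Prod.snd := by
  induction h with
  | nil u => exact List.mem_singleton_self u
  | cons _ _ _ ih => exact List.mem_cons_of_mem _ ih

theorem Walk.endpoints_mem {l : List (E × V)} {u v : V} {g : G} (h : Φ.Walk S u l v g)
    {e : E} (he : e ∈ l.map Prod.fst) {x y : V} {g' : G} (hs : Φ.Step e x y g') :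
    x ∈ u :: l.map Prod.snd ∧ y ∈ u :: l.map Prod.snd := by
  induction h with
  | nil u => simp only [List.map_nil, List.not_mem_nil] at he
  | cons _ hs' _ ih =>
    rcases List.mem_cons.1 he with rfl | he
    · rcases hs.eq_or_eq_symm hs' with ⟨rfl, rfl, -⟩ | ⟨rfl, rfl, -⟩ <;> simp
    · exact (ih he).imp (List.mem_cons_of_mem _) (List.mem_cons_of_mem _)

theorem Walk.eq_zero_of_nodup {l : List (E × V)} {u : V} {g : G} (h : Φ.Walk S u l u g)
    (hn : (u :: l.map Prod.snd).Nodup) : g = 0 := by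
  cases h with
  | nil => rfl
  | cons _ _ hw => exact absurd hw.end_mem (List.nodup_cons.1 hn).1

theorem Walk.nodup_edges {l : List (E × V)} {u v : V} {g : G} (h : Φ.Walk S u l v g)
    (hn : (u :: l.map Prod.snd).Nodup) : (l.map Prod.fst).Nodup := by
  induction h with
  | nil u => exact List.nodup_nil
  | cons _ hs hw ih =>
    obtain ⟨hu, hn⟩ := List.nodup_cons.1 hn
    exact List.nodup_cons.2 ⟨fun he => hu (hw.endpoints_mem he hs).1, ih hn⟩

theorem Walk.exists_split {l : List (E × V)} {u v w : V} {g : G} (h : Φ.Walk S u l w g)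
    (hv : v ∈ u :: l.map Prod.snd) :
    ∃ l₁ l₂ g₁ g₂, Φ.Walk S u l₁ v g₁ ∧ Φ.Walk S v l₂ w g₂ ∧ g₁ + g₂ = g ∧
      (u :: l₁.map Prod.snd).Sublist (u :: l.map Prod.snd) ∧
      (v :: l₂.map Prod.snd).Sublist (u :: l.map Prod.snd) := by
  induction h with
  | nil u =>
    obtain rfl := List.mem_singleton.1 hv
    exact ⟨[], [], 0, 0, Walk.nil v, Walk.nil v, add_zero 0, List.Sublist.refl _,
      List.Sublist.refl _⟩
  | @cons e u x w g g' l he hs hw ih =>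
    rcases List.mem_cons.1 hv with rfl | hv
    · exact ⟨[], _, 0, _, Walk.nil v, Walk.cons he hs hw, zero_add _, by simp,
        List.Sublist.refl _⟩
    · obtain ⟨l₁, l₂, g₁, g₂, h₁, h₂, rfl, hl₁, hl₂⟩ := ih hv
      exact ⟨_, l₂, _, g₂, Walk.cons he hs h₁, h₂, add_assoc _ _ _, hl₁.cons_cons u,
        hl₂.cons u⟩

theorem Balanced.step_add_eq_zero (hS : Φ.Balanced S) {e : E} {u v : V} {g g' : G} (he : e ∈ S)
    (hs : Φ.Step e u v g) (h : Φ.PathGain S v u g') : g + g' = 0 := by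
  obtain ⟨l, hw, hn⟩ := h
  by_cases hel : e ∈ l.map Prod.fst
  · cases hw with
    | nil => simp only [List.map_nil, List.not_mem_nil] at hel
    | cons _ hs' hw =>
      obtain ⟨hv, hn⟩ := List.nodup_cons.1 hn
      rcases List.mem_cons.1 hel with rfl | hel
      · rcases hs.eq_or_eq_symm hs' with ⟨rfl, rfl, -⟩ | ⟨rfl, -, rfl⟩
        · exact absurd List.mem_cons_self hv
        · rw [hw.eq_zero_of_nodup hn, add_zero, neg_add_cancel]
      · exact absurd (hw.endpoints_mem hel hs).2 hv
  · exact hS.2 u _ ⟨(e, v) :: l, List.cons_ne_nil _ _, Walk.cons he hs hw,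
      List.nodup_cons.2 ⟨hel, hw.nodup_edges hn⟩, hn⟩

theorem Balanced.pathGain_of_walk (hS : Φ.Balanced S) {l : List (E × V)} {u v : V} {g : G}
    (h : Φ.Walk S u l v g) : Φ.PathGain S u v g := by
  induction h with
  | nil u => exact ⟨[], Walk.nil u, List.nodup_singleton u⟩
  | @cons e u v w g g' l he hs _ ih =>
    obtain ⟨l', hw, hn⟩ := ih
    by_cases hu : u ∈ v :: l'.map Prod.snd
    · obtain ⟨l₁, l₂, g₁, g₂, h₁, h₂, rfl, hl₁, hl₂⟩ := hw.exists_split hu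
      have hcancel : g + g₁ = 0 := hS.step_add_eq_zero he hs ⟨l₁, h₁, hn.sublist hl₁⟩
      rw [← add_assoc, hcancel, zero_add]
      exact ⟨l₂, h₂, hn.sublist hl₂⟩
    · exact ⟨(e, v) :: l', Walk.cons he hs hw, List.nodup_cons.2 ⟨hu, hn⟩⟩

theorem Balanced.closed_walk_eq_zero (hS : Φ.Balanced S) {l : List (E × V)} {v : V} {g : G}
    (h : Φ.Walk S v l v g) : g = 0 :=
  let ⟨_, hw, hn⟩ := hS.pathGain_of_walk h
  hw.eq_zero_of_nodup hn

/-- `η` is a potential on `S`: switching by `η` turns the gains of all edges in `S` into `0`. This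
is the first half of `IsTopSwitching`. -/
def IsPotential (Φ : GainGraph V E G) (S : Finset E) (η : V → G) : Prop :=
  ∀ e ∈ S, ∀ u v g, Φ.Step e u v g → -η u + g + η v = 0

theorem IsPotential.gain_eq_sub {η : V → G} (hη : Φ.IsPotential S η) {l : List (E × V)} {u v : V}
    {g : G} (h : Φ.Walk S u l v g) : g = η u - η v := by
  induction h with
  | nil u => rw [sub_self]
  | @cons e u v w g g' l he hs _ ih =>
    rw [ih, ← sub_eq_zero, ← hη e he u v g hs]
    abel

section Components

variable [Fintype V]

theorem mem_component {u v : V} : v ∈ Φ.component S u ↔ ∃ l g, Φ.Walk S u l v g := by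
  simp only [component, Finset.mem_filter_univ]

theorem self_mem_component (u : V) : u ∈ Φ.component S u :=
  mem_component.2 ⟨[], 0, Walk.nil u⟩

theorem component_eq_of_mem {u v : V} (h : v ∈ Φ.component S u) :
    Φ.component S v = Φ.component S u := by
  obtain ⟨l, g, h⟩ := mem_component.1 h
  obtain ⟨l', h'⟩ := h.exists_reverse
  ext w
  simp only [mem_component]
  constructor
  · rintro ⟨l₁, g₁, h₁⟩
    exact ⟨_, _, h.append h₁⟩
  · rintro ⟨l₁, g₁, h₁⟩
    exact ⟨_, _, h'.append h₁⟩

theorem Step.component_eq {e : E} {u v : V} {g : G} (hs : Φ.Step e u v g) (he : e ∈ S) :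
    Φ.component S v = Φ.component S u :=
  component_eq_of_mem (mem_component.2 ⟨_, _, Walk.single he hs⟩)

theorem mem_parts {W : Finset V} : W ∈ Φ.parts S ↔ ∃ u, Φ.component S u = W := by
  simp only [parts, Finset.mem_image, Finset.mem_univ, true_and]

theorem component_mem_parts (u : V) : Φ.component S u ∈ Φ.parts S :=
  mem_parts.2 ⟨u, rfl⟩

theorem component_eq_of_mem_parts {W : Finset V} (hW : W ∈ Φ.parts S) {u : V} (hu : u ∈ W) :
    Φ.component S u = W := by
  obtain ⟨w, rfl⟩ := mem_parts.1 hW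
  exact component_eq_of_mem hu

theorem nonempty_of_mem_parts {W : Finset V} (hW : W ∈ Φ.parts S) : W.Nonempty := by
  obtain ⟨w, rfl⟩ := mem_parts.1 hW
  exact ⟨w, self_mem_component w⟩

theorem exists_walk_of_mem_parts {W : Finset V} (hW : W ∈ Φ.parts S) {u v : V} (hu : u ∈ W)
    (hv : v ∈ W) : ∃ l g, Φ.Walk S u l v g := by
  rw [← component_eq_of_mem_parts hW hu] at hv
  exact mem_component.1 hv

theorem IsPotential.isPotential_neg_iff {η x : V → G} (hη : Φ.IsPotential S η) :
    Φ.IsPotential S (-x) ↔ ∀ u, ∀ v ∈ Φ.component S u, x v + η v = x u + η u := by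
  constructor
  · intro hx u v hv
    obtain ⟨l, g, hw⟩ := mem_component.1 hv
    have hgain := (hx.gain_eq_sub hw).symm.trans (hη.gain_eq_sub hw)
    simp only [Pi.neg_apply, sub_neg_eq_add, neg_add_eq_sub, sub_eq_sub_iff_add_eq_add] at hgain
    rw [hgain, add_comm]
  · intro hconst e he u v g hs
    have hgain := hη.gain_eq_sub (Walk.single he hs)
    have hxv := hconst u v (mem_component.2 ⟨_, _, Walk.single he hs⟩)
    rw [Pi.neg_apply, Pi.neg_apply, eq_sub_of_add_eq hxv, hgain]
    abel

end Components

theorem Balanced.exists_isPotential [Finite V] (hS : Φ.Balanced S) :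
    ∃ η : V → G, Φ.IsPotential S η := by
  have := Fintype.ofFinite V
  choose r hr using fun W : {W // W ∈ Φ.parts S} => nonempty_of_mem_parts W.2
  have hroot : ∀ u, ∃ g l, Φ.Walk S u l (r ⟨_, component_mem_parts u⟩) g := fun u =>
    let ⟨l, g, h⟩ := mem_component.1 (hr ⟨_, component_mem_parts u⟩)
    ⟨g, l, h⟩
  choose η l hη using hroot
  refine ⟨η, fun e he u v g hs => ?_⟩
  obtain ⟨l', hback⟩ := (hη u).exists_reverse
  have hforth := hη v
  simp only [hs.component_eq he] at hforth
  rw [add_assoc]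
  exact hS.closed_walk_eq_zero (hback.append (Walk.cons he hs hforth))

variable [Fintype V]

theorem Balanced.exists_isTopSwitching [Lattice G] [IsOrderedAddMonoid G] (hS : Φ.Balanced S) :
    ∃ η : V → G, Φ.IsTopSwitching S η := by
  obtain ⟨η, hη⟩ := hS.exists_isPotential
  have hne (u : V) : (Φ.component S u).Nonempty := ⟨u, self_mem_component u⟩
  refine ⟨fun u => η u - (Φ.component S u).inf' (hne u) η, fun e he u v g hs => ?_, ?_⟩
  · simp only [hs.component_eq he]
    rw [← hη e he u v g hs]
    abel
  · intro W hW
    obtain ⟨w, rfl⟩ := mem_parts.1 hW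
    constructor
    · rintro _ ⟨u, -, rfl⟩
      exact sub_nonneg.2 (Finset.inf'_le η (self_mem_component u))
    · intro b hb
      suffices b + (Φ.component S w).inf' (hne w) η ≤ (Φ.component S w).inf' (hne w) η from
        add_le_iff_nonpos_left.1 this
      refine Finset.le_inf' _ _ fun u hu => ?_
      have hbu := hb (Set.mem_image_of_mem _ hu)
      simp only [component_eq_of_mem hu] at hbu
      exact le_sub_iff_add_le.1 hbu

theorem Balanced.isTopSwitching [Lattice G] [IsOrderedAddMonoid G] (hS : Φ.Balanced S) :
    Φ.IsTopSwitching S (Φ.topSwitching S) :=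
  Classical.epsilon_spec hS.exists_isTopSwitching

theorem Balanced.isPotential_topSwitching [Lattice G] [IsOrderedAddMonoid G]
    (hS : Φ.Balanced S) : Φ.IsPotential S (Φ.topSwitching S) :=
  hS.isTopSwitching.1

end Walks

end GainGraph

section ConeLists

variable {d : ℕ} {H : Set (Fin d → ℤ)}

namespace IsConeMinusFinite

theorem nonempty (hd : 0 < d) (hH : IsConeMinusFinite H) : H.Nonempty := by
  obtain ⟨a, A, hA, -, rfl⟩ := hH
  have : Nonempty (Fin d) := ⟨⟨0, hd⟩⟩
  exact ((Set.Ici_infinite a).sdiff hA).nonempty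

theorem bddBelow (hH : IsConeMinusFinite H) : BddBelow H := by
  obtain ⟨a, A, -, -, rfl⟩ := hH
  exact ⟨a, fun x hx => hx.1⟩

theorem apex_le (hH : IsConeMinusFinite H) {x : Fin d → ℤ} (hx : x ∈ H) : apex H ≤ x :=
  csInf_le hH.bddBelow hx

theorem finite_holes (hd : 0 < d) (hH : IsConeMinusFinite H) : (holes H).Finite := by
  have hne := hH.nonempty hd
  obtain ⟨a, A, hA, -, rfl⟩ := hH
  have ha : a ≤ apex (Set.Ici a \ A) := le_csInf hne fun x hx => hx.1
  exact hA.subset fun x hx => by_contra fun hxA => hx.2 ⟨ha.trans hx.1, hxA⟩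

theorem mem_iff (hH : IsConeMinusFinite H) {x : Fin d → ℤ} :
    x ∈ H ↔ apex H ≤ x ∧ x ∉ holes H :=
  ⟨fun hx => ⟨hH.apex_le hx, fun h => h.2 hx⟩, fun ⟨h₁, h₂⟩ => by_contra fun h => h₂ ⟨h₁, h⟩⟩

theorem le_holeTop (hd : 0 < d) (hH : IsConeMinusFinite H) {x : Fin d → ℤ} (hx : x ∈ holes H) :
    x ≤ holeTop H := by
  rw [holeTop, if_neg (Set.nonempty_iff_ne_empty.1 ⟨x, hx⟩)]
  exact le_csSup (hH.finite_holes hd).bddAbove hx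

theorem apex_sub_one_le_holeTop (hd : 0 < d) (hH : IsConeMinusFinite H) :
    apex H - 1 ≤ holeTop H := by
  rcases (holes H).eq_empty_or_nonempty with h | ⟨x, hx⟩
  · rw [holeTop, if_pos h]
  · exact (sub_le_self _ zero_le_one).trans (hx.1.trans (hH.le_holeTop hd hx))

end IsConeMinusFinite

end ConeLists

namespace GainGraph

section Bounds

variable {V E G : Type*} [AddCommGroup G] {Φ : GainGraph V E G} {S : Finset E}

theorem finite_setOf_step [Finite E] : {g | ∃ e u v, Φ.Step e u v g}.Finite := by
  simp only [Set.ofPred_exists]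
  refine Set.finite_iUnion fun e => ?_
  cases he : Φ.edge e with
  | arc u v g =>
    refine (Set.toFinite {g, -g}).subset (Set.iUnion₂_subset fun u' v' g' hs => ?_)
    rcases hs.eq_or_eq_symm (Or.inl he : Φ.Step e u v g) with ⟨-, -, rfl⟩ | ⟨-, -, rfl⟩ <;> simp
  | half v => simp [Step, he]
  | loose => simp [Step, he]

theorem finite_setOf_walk_gain [Finite E] (n : ℕ) :
    {g | ∃ u l v, Φ.Walk S u l v g ∧ l.length = n}.Finite := by
  induction n with
  | zero =>
    refine (Set.finite_singleton (0 : G)).subset ?_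
    rintro g ⟨u, l, v, h, hl⟩
    obtain rfl := List.length_eq_zero_iff.1 hl
    cases h
    rfl
  | succ n ih =>
    refine (Set.Finite.image2 (· + ·) (finite_setOf_step (Φ := Φ)) ih).subset ?_
    rintro g ⟨u, l, v, h, hl⟩
    cases h with
    | nil => cases hl
    | cons _ hs hw => exact ⟨_, ⟨_, _, _, hs⟩, _, ⟨_, _, _, hw, Nat.succ_inj.1 hl⟩, rfl⟩

theorem finite_setOf_pathGain [Finite V] [Finite E] (u v : V) :
    {g | Φ.PathGain S u v g}.Finite := by
  have := Fintype.ofFinite V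
  refine ((Set.finite_lt_nat (Fintype.card V)).biUnion
    fun n _ => finite_setOf_walk_gain (Φ := Φ) (S := S) n).subset ?_
  rintro g ⟨l, h, hn⟩
  have hlt : l.length < Fintype.card V := by
    simpa only [List.length_cons, List.length_map, Nat.succ_le_iff] using hn.length_le_card
  exact Set.mem_biUnion hlt ⟨u, l, v, h, rfl⟩

variable {d : ℕ} {Φ : GainGraph V E (Fin d → ℤ)} (H : V → Set (Fin d → ℤ))

theorem PathGain.holeTop_add_le_bound [Finite V] [Fintype E] {i j : V} {g : Fin d → ℤ}
    (h : Φ.PathGain Finset.univ j i g) : holeTop (H j) + g ≤ Φ.bound H i := by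
  have hα : g ≤ Φ.alpha j i := le_csSup (finite_setOf_pathGain j i).bddAbove h
  refine (add_le_add_right hα _).trans (le_csSup (Set.Finite.bddAbove ?_) ⟨j, ⟨g, h⟩, rfl⟩)
  refine (Set.finite_range fun j => holeTop (H j) + Φ.alpha j i).subset ?_
  rintro _ ⟨j, -, rfl⟩
  exact ⟨j, rfl⟩

theorem Balanced.holeTop_add_topSwitching_le [Fintype V] [Fintype E] {B : Finset E}
    (hB : Φ.Balanced B) {W : Finset V} (hW : W ∈ Φ.parts B) {i j : V} (hi : i ∈ W) (hj : j ∈ W) :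
    holeTop (H j) + Φ.topSwitching B j ≤ Φ.bound H i + Φ.topSwitching B i := by
  obtain ⟨l, g, h⟩ := exists_walk_of_mem_parts hW hj hi
  have hle := ((hB.pathGain_of_walk h).mono (Finset.subset_univ B)).holeTop_add_le_bound H
  rw [hB.isPotential_topSwitching.gain_eq_sub h, ← add_sub_assoc] at hle
  exact sub_le_iff_le_add.1 hle

end Bounds

section MoebiusCount

variable {V E G : Type*} [AddCommGroup G] {Φ : GainGraph V E G}

theorem balanced_closed_empty (hloop : ∀ e v, ¬ Φ.Step e v v 0)
    (hloose : ∀ e, Φ.edge e ≠ GainEdge.loose) : Φ.Balanced ∅ ∧ Φ.Closed ∅ := by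
  refine ⟨⟨fun e he => absurd he (Finset.notMem_empty e), fun v g ⟨l, _, h, _⟩ => ?_⟩,
    fun e he => absurd he (hloose e), fun e u v g ⟨l, h, _⟩ hs => ?_⟩
  · cases h with
    | nil => rfl
    | cons he => exact absurd he (Finset.notMem_empty _)
  · cases h with
    | nil => exact absurd hs (hloop e u)
    | cons he => exact absurd he (Finset.notMem_empty _)

/-- The colors that are allowed on all of `W` after the lists `Y` have been switched by `η`. -/
def commonColors (η : V → G) (Y : V → Set G) (W : Finset V) : Set G :=
  {c | ∀ i ∈ W, c - η i ∈ Y i}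

theorem ncard_constant_on_components [Fintype V] {S : Finset E} (η : V → G) (Y : V → Set G) :
    {x : V → G | (∀ i, x i ∈ Y i) ∧
        ∀ u, ∀ v ∈ Φ.component S u, x v + η v = x u + η u}.ncard =
      ∏ W ∈ Φ.parts S, (commonColors η Y W).ncard := by
  classical
  simp only [← Nat.card_coe_set_eq]
  rw [← Finset.prod_coe_sort, ← Nat.card_pi]
  choose r hr using fun W : Φ.parts S => nonempty_of_mem_parts W.2
  refine Nat.card_congr
    { toFun := fun x W => ⟨x.1 (r W) + η (r W), fun i hi => ?_⟩
      invFun := fun c => ⟨fun i => (c ⟨_, component_mem_parts i⟩).1 - η i, fun i => ?_, ?_⟩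
      left_inv := fun x => Subtype.ext (funext fun i => ?_)
      right_inv := fun c => funext fun W => Subtype.ext ?_ }
  · rw [← x.2.2 _ i (by rwa [component_eq_of_mem_parts W.2 (hr W)]), add_sub_cancel_right]
    exact x.2.1 i
  · exact (c ⟨_, component_mem_parts i⟩).2 i (self_mem_component i)
  · intro u v hv
    simp only [sub_add_cancel]
    exact congrArg (fun W => (c W).1) (Subtype.ext (component_eq_of_mem hv))
  · simp only [x.2.2 i _ (hr ⟨_, component_mem_parts i⟩), add_sub_cancel_right]
  · simp only [sub_add_cancel]
    exact congrArg (fun W => (c W).1) (Subtype.ext (component_eq_of_mem_parts W.2 (hr W)))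

variable [Fintype E]

open Classical in
/-- The edges that the coloration `x` makes improper; half edges and loose edges are always
proper. -/
noncomputable def improperEdges (Φ : GainGraph V E G) (x : V → G) : Finset E :=
  {e | ∃ u v g, Φ.Step e u v g ∧ x v = x u + g}

theorem mem_improperEdges {x : V → G} {e : E} :
    e ∈ Φ.improperEdges x ↔ ∃ u v g, Φ.Step e u v g ∧ x v = x u + g := by
  simp only [improperEdges, Finset.mem_filter_univ]

theorem Step.mem_improperEdges_iff {x : V → G} {e : E} {u v : V} {g : G} (hs : Φ.Step e u v g) :
    e ∈ Φ.improperEdges x ↔ x v = x u + g := by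
  rw [mem_improperEdges]
  refine ⟨fun ⟨u', v', g', hs', hx⟩ => ?_, fun hx => ⟨u, v, g, hs, hx⟩⟩
  rcases hs.eq_or_eq_symm hs' with ⟨rfl, rfl, rfl⟩ | ⟨rfl, rfl, rfl⟩
  · exact hx
  · rw [hx, add_neg_cancel_right]

theorem improperEdges_eq_empty_iff {x : V → G} :
    Φ.improperEdges x = ∅ ↔ ∀ e u v g, Φ.Step e u v g → x v ≠ x u + g := by
  simp only [Finset.eq_empty_iff_forall_notMem, mem_improperEdges, not_exists, not_and, ne_eq]

theorem isPotential_neg_improperEdges (x : V → G) :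
    Φ.IsPotential (Φ.improperEdges x) (-x) := by
  intro e he u v g hs
  rw [Pi.neg_apply, Pi.neg_apply, hs.mem_improperEdges_iff.1 he]
  abel

theorem IsPotential.subset_improperEdges {S : Finset E} {x : V → G} (hx : Φ.IsPotential S (-x))
    (hS : Φ.Balanced S) (hloose : ∀ e, Φ.edge e ≠ GainEdge.loose) :
    S ⊆ Φ.improperEdges x := by
  intro e he
  obtain ⟨u, v, g, hs⟩ := exists_step (hS.1 e he) (hloose e)
  rw [hs.mem_improperEdges_iff, eq_comm, ← sub_eq_zero, ← hx e he u v g hs, Pi.neg_apply,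
    Pi.neg_apply]
  abel

theorem balanced_improperEdges (x : V → G) : Φ.Balanced (Φ.improperEdges x) := by
  refine ⟨fun e he w hw => ?_, fun v g ⟨l, _, h, _⟩ => ?_⟩
  · obtain ⟨u, v, g, h | h, -⟩ := mem_improperEdges.1 he <;> rw [hw] at h <;> cases h
  · rw [(isPotential_neg_improperEdges x).gain_eq_sub h, sub_self]

theorem closed_improperEdges (hloose : ∀ e, Φ.edge e ≠ GainEdge.loose) (x : V → G) :
    Φ.Closed (Φ.improperEdges x) := by
  refine ⟨fun e he => absurd he (hloose e), fun e u v g ⟨l, h, _⟩ hs => ?_⟩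
  rw [hs.mem_improperEdges_iff, (isPotential_neg_improperEdges x).gain_eq_sub h, Pi.neg_apply,
    Pi.neg_apply]
  abel

theorem muEmpty_empty (h : Φ.Balanced ∅ ∧ Φ.Closed ∅) : Φ.muEmpty ⟨∅, h⟩ = 1 := by
  simp only [muEmpty, dif_pos h, IncidenceAlgebra.mu_self]

open Classical in
theorem sum_muEmpty_of_subset (h₀ : Φ.Balanced ∅ ∧ Φ.Closed ∅) (I : Φ.Latb) :
    ∑ B : Φ.Latb with B.1 ⊆ I.1, Φ.muEmpty B = if I.1 = ∅ then 1 else 0 := by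
  let _ : LocallyFiniteOrder Φ.Latb := Fintype.toLocallyFiniteOrder
  have hempty : (⟨∅, h₀⟩ : Φ.Latb) = I ↔ I.1 = ∅ := Subtype.ext_iff.trans eq_comm
  have hinterval : Finset.Icc (⟨∅, h₀⟩ : Φ.Latb) I =
      ({B | B.1 ⊆ I.1} : Finset Φ.Latb) := by
    ext B
    rw [Finset.mem_Icc, Finset.mem_filter_univ]
    exact and_iff_right (Finset.empty_subset B.1)
  simp only [muEmpty, dif_pos h₀]
  rw [← hinterval, IncidenceAlgebra.sum_Icc_mu_right]
  exact if_congr hempty rfl rfl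

open Classical in
theorem card_filter_improperEdges_eq_empty (hloop : ∀ e v, ¬ Φ.Step e v v 0)
    (hloose : ∀ e, Φ.edge e ≠ GainEdge.loose) (X : Finset (V → G)) :
    ((X.filter fun x => Φ.improperEdges x = ∅).card : ℤ) =
      ∑ B : Φ.Latb, Φ.muEmpty B * ((X.filter fun x => B.1 ⊆ Φ.improperEdges x).card : ℤ) := by
  simp only [Finset.natCast_card_filter, Finset.mul_sum, mul_ite, mul_one, mul_zero]
  rw [Finset.sum_comm]
  refine Finset.sum_congr rfl fun x _ => ?_
  rw [← Finset.sum_filter]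
  exact (sum_muEmpty_of_subset (balanced_closed_empty hloop hloose)
    ⟨_, balanced_improperEdges x, closed_improperEdges hloose x⟩).symm

open Classical in
theorem ncard_properColorings_eq_sum [Fintype V] (hloop : ∀ e v, ¬ Φ.Step e v v 0)
    (hloose : ∀ e, Φ.edge e ≠ GainEdge.loose) {η : Finset E → V → G}
    (hη : ∀ B, Φ.Balanced B → Φ.IsPotential B (η B)) {Y : V → Set G} (hY : ∀ i, (Y i).Finite) :
    (({x | (∀ i, x i ∈ Y i) ∧ ∀ e u v g, Φ.Step e u v g → x v ≠ x u + g} :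
        Set (V → G)).ncard : ℤ) =
      ∑ B : Φ.Latb, Φ.muEmpty B * ∏ W ∈ Φ.parts B.1, ((commonColors (η B.1) Y W).ncard : ℤ) := by
  set X : Finset (V → G) := (Set.Finite.pi' hY).toFinset
  have hX (x : V → G) : x ∈ X ↔ ∀ i, x i ∈ Y i := Set.Finite.mem_toFinset _
  have hproper : {x : V → G | (∀ i, x i ∈ Y i) ∧ ∀ e u v g, Φ.Step e u v g → x v ≠ x u + g} =
      ↑(X.filter fun x => Φ.improperEdges x = ∅) := by
    ext x
    simp only [Finset.coe_filter, Set.mem_ofPred_eq, hX, improperEdges_eq_empty_iff]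
  rw [hproper, Set.ncard_coe_finset, card_filter_improperEdges_eq_empty hloop hloose]
  refine Finset.sum_congr rfl fun B _ => ?_
  rw [← Nat.cast_prod, ← ncard_constant_on_components, ← Set.ncard_coe_finset]
  congr 3
  ext x
  simp only [Finset.coe_filter, Set.mem_ofPred_eq, hX, ← (hη B.1 B.2.1).isPotential_neg_iff]
  exact and_congr_right fun _ =>
    ⟨fun h e he => isPotential_neg_improperEdges x e (h he),
      fun h => h.subset_improperEdges B.2.1 hloose⟩

end MoebiusCount

end GainGraph

section TruncatedCount

variable {κ : Type*} [Fintype κ]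

/-- The number of points of the box `Set.Icc a t` outside the set `S` of holes, extended
continuously from integral to real `t`: the sides of the box are truncated at `0`, and a hole is
counted gradually as `t` reaches it. -/
noncomputable def truncatedCount (a : κ → ℤ) (S : Set (κ → ℤ)) (t : κ → ℝ) : ℝ :=
  ∏ k, max (t k - a k + 1) 0 - ∑ᶠ c ∈ S, ∏ k, max 0 (min 1 (t k - c k + 1))

theorem max_zero_min_one_intCast_sub_add_one (m n : ℤ) :
    max 0 (min 1 ((n : ℝ) - m + 1)) = if m ≤ n then 1 else 0 := by
  split_ifs with h
  · have : (m : ℝ) ≤ n := Int.cast_le.2 h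
    rw [min_eq_left (by linarith), max_eq_right zero_le_one]
  · have : (n : ℝ) + 1 ≤ m := by exact_mod_cast not_le.1 h
    exact max_eq_left ((min_le_right _ _).trans (by linarith))

theorem ncard_Icc_eq_prod_max (a b : κ → ℤ) :
    ((Set.Icc a b).ncard : ℝ) = ∏ k, max ((b k : ℝ) - a k + 1) 0 := by
  classical
  rw [← Finset.coe_Icc, Set.ncard_coe_finset, Pi.card_Icc, Nat.cast_prod]
  refine Finset.prod_congr rfl fun k _ => ?_
  rw [Int.card_Icc, ← Int.cast_natCast, Int.toNat_eq_max, add_sub_right_comm]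
  push_cast
  rfl

theorem ncard_Icc_sdiff_eq_truncatedCount {a : κ → ℤ} {S : Set (κ → ℤ)} (hS : S.Finite)
    (ha : ∀ c ∈ S, a ≤ c) (b : κ → ℤ) :
    ((Set.Icc a b \ S).ncard : ℝ) = truncatedCount a S fun k => b k := by
  classical
  have hhit : Set.Icc a b ∩ S = ↑(hS.toFinset.filter (· ≤ b)) := by
    ext c
    simp only [Set.mem_inter_iff, Set.mem_Icc, Finset.coe_filter, Set.Finite.mem_toFinset,
      Set.mem_ofPred_eq]
    exact ⟨fun h => ⟨h.2, h.1.2⟩, fun h => ⟨⟨ha c h.1, h.2⟩, h.1⟩⟩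
  have hcount : ((Set.Icc a b ∩ S).ncard : ℝ) =
      ∑ᶠ c ∈ S, ∏ k, max 0 (min 1 ((b k : ℝ) - c k + 1)) := by
    rw [hhit, Set.ncard_coe_finset, Finset.natCast_card_filter,
      finsum_mem_eq_finite_toFinset_sum _ hS]
    refine Finset.sum_congr rfl fun c _ => ?_
    simp only [max_zero_min_one_intCast_sub_add_one, Finset.prod_ite_zero, Finset.mem_univ,
      true_imp_iff, Finset.prod_const_one, Pi.le_def]
  rw [truncatedCount, ← ncard_Icc_eq_prod_max, ← hcount, eq_sub_iff_add_eq, add_comm]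
  exact_mod_cast Set.ncard_inter_add_ncard_sdiff_eq_ncard _ S (Set.finite_Icc a b)

theorem truncatedCount_eq_prod_sub_ncard {a : κ → ℤ} {S : Set (κ → ℤ)} (hS : S.Finite)
    {t : κ → ℝ} (ha : ∀ k, (a k : ℝ) - 1 ≤ t k) (ht : ∀ c ∈ S, ∀ k, (c k : ℝ) ≤ t k) :
    truncatedCount a S t = ∏ k, (t k - a k + 1) - S.ncard := by
  rw [truncatedCount]
  congr 1
  · exact Finset.prod_congr rfl fun k _ => max_eq_left (by linarith [ha k])
  · rw [finsum_mem_eq_finite_toFinset_sum _ hS, Set.ncard_eq_toFinset_card _ hS,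
      Finset.card_eq_sum_ones, Nat.cast_sum]
    refine Finset.sum_congr rfl fun c hc => ?_
    rw [Nat.cast_one]
    refine Finset.prod_eq_one fun k _ => ?_
    rw [min_eq_left (by linarith [ht c (hS.mem_toFinset.1 hc) k]), max_eq_right zero_le_one]

end TruncatedCount

namespace GainGraph

section Corners

variable {V E : Type*} {d : ℕ}

/-- The join of the apices of the lists in `W` after switching by `η`. -/
noncomputable def switchedApex (H : V → Set (Fin d → ℤ)) (η : V → Fin d → ℤ) (W : Finset V) :
    Fin d → ℤ :=
  ⨆ i : W, (apex (H i) + η i)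

/-- The meet of the upper bounds in `W` after switching by `η`, for real upper bounds. -/
noncomputable def switchedTop (η : V → Fin d → ℤ) (W : Finset V) (y : V × Fin d → ℝ)
    (k : Fin d) : ℝ :=
  ⨅ i : W, (y (i, k) + η i k)

variable {H : V → Set (Fin d → ℤ)} {η : V → Fin d → ℤ} {W : Finset V}

theorem switchedApex_le_iff (hW : W.Nonempty) {c : Fin d → ℤ} :
    switchedApex H η W ≤ c ↔ ∀ i ∈ W, apex (H i) + η i ≤ c := by
  have : Nonempty W := hW.to_subtype
  rw [switchedApex, ciSup_le_iff (Set.finite_range _).bddAbove, Subtype.forall]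

theorem switchedApex_apply (hW : W.Nonempty) (k : Fin d) :
    (switchedApex H η W k : ℝ) = ⨆ i : W, ((apex (H i) k : ℝ) + (η i k : ℝ)) := by
  have : Nonempty W := hW.to_subtype
  rw [switchedApex, iSup_apply, (Int.gc_coe_floor (α := ℝ)).l_ciSup (Set.finite_range _).bddAbove]
  simp only [Pi.add_apply, Int.cast_add]

theorem switchedTop_intCast (hW : W.Nonempty) (m : V → Fin d → ℤ) (k : Fin d) :
    switchedTop η W (fun ik => m ik.1 ik.2) k = ((⨅ i : W, (m i + η i)) k : ℤ) := by
  have : Nonempty W := hW.to_subtype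
  rw [iInf_apply, (Int.gc_ceil_coe (α := ℝ)).u_ciInf (Set.finite_range _).bddBelow]
  simp only [switchedTop, Pi.add_apply, Int.cast_add]

theorem finite_setOf_mem_list_le (hH : ∀ i, IsConeMinusFinite (H i)) (m : V → Fin d → ℤ) (i : V) :
    {c | c ∈ H i ∧ c ≤ m i}.Finite :=
  (Set.finite_Icc (apex (H i)) (m i)).subset fun _ hc => ⟨(hH i).apex_le hc.1, hc.2⟩

theorem finite_properColorations [Finite V] {Φ : GainGraph V E (Fin d → ℤ)}
    (hH : ∀ i, IsConeMinusFinite (H i)) (m : V → Fin d → ℤ) :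
    (Φ.properColorations H m).Finite :=
  (Set.Finite.pi' (finite_setOf_mem_list_le hH m)).subset fun _ hx => hx.1

variable [Fintype V] {Φ : GainGraph V E (Fin d → ℤ)} {B : Finset E}

theorem finite_switchedHoles (hd : 0 < d) (hH : ∀ i, IsConeMinusFinite (H i)) :
    (Φ.switchedHoles H B W).Finite := by
  refine (Set.finite_iUnion fun i => ((hH i).finite_holes hd).image
    (· + Φ.topSwitching B i)).subset ?_
  rintro c ⟨⟨i, -, a, ha, rfl⟩, -⟩
  exact Set.mem_iUnion.2 ⟨i, a, ha, rfl⟩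

theorem q_eq_switchedTop_sub (hW : W.Nonempty) (k : Fin d) (y : V × Fin d → ℝ) :
    Φ.q H B W k y =
      switchedTop (Φ.topSwitching B) W y k - switchedApex H (Φ.topSwitching B) W k + 1 := by
  rw [switchedApex_apply hW]
  rfl

theorem commonColors_topSwitching (hH : ∀ i, IsConeMinusFinite (H i)) (hW : W.Nonempty)
    (m : V → Fin d → ℤ) :
    commonColors (Φ.topSwitching B) (fun i => {c | c ∈ H i ∧ c ≤ m i}) W =
      Set.Icc (switchedApex H (Φ.topSwitching B) W) (⨅ i : W, (m i + Φ.topSwitching B i)) \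
        Φ.switchedHoles H B W := by
  have : Nonempty W := hW.to_subtype
  ext c
  rw [Set.mem_sdiff, Set.mem_Icc, switchedApex_le_iff hW,
    le_ciInf_iff (Set.finite_range _).bddBelow, Subtype.forall]
  constructor
  · intro h
    refine ⟨⟨fun i hi => le_sub_iff_add_le.1 ((hH i).apex_le (h i hi).1),
      fun i hi => sub_le_iff_le_add.1 (h i hi).2⟩, ?_⟩
    rintro ⟨⟨i, hi, a, ha, rfl⟩, -⟩
    exact ha.2 (add_sub_cancel_right a _ ▸ (h i hi).1)
  · rintro ⟨⟨hapex, htop⟩, hhole⟩ i hi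
    refine ⟨(hH i).mem_iff.2 ⟨le_sub_iff_add_le.2 (hapex i hi), fun ha => hhole ?_⟩,
      sub_le_iff_le_add.2 (htop i hi)⟩
    exact ⟨⟨i, hi, _, ha, (sub_add_cancel c _).symm⟩, hapex⟩

end Corners

section RealChromatic

variable {V E : Type*} [Fintype V] {d : ℕ} (Φ : GainGraph V E (Fin d → ℤ))
  (H : V → Set (Fin d → ℤ))

/-- The contribution of the component `W` of `B` to the list chromatic function, extended
continuously to real upper bounds. -/
noncomputable def componentCount (B : Finset E) (W : Finset V) (y : V × Fin d → ℝ) : ℝ :=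
  truncatedCount (switchedApex H (Φ.topSwitching B) W) (Φ.switchedHoles H B W)
    (switchedTop (Φ.topSwitching B) W y)

open Classical in
/-- The continuous extension of the list chromatic function to real upper bounds. -/
noncomputable def realChromatic [Fintype E] (y : V × Fin d → ℝ) : ℝ :=
  ∑ B : Φ.Latb, (Φ.muEmpty B : ℝ) * ∏ W ∈ Φ.parts B.1, Φ.componentCount H B.1 W y

variable {Φ H} {B : Finset E} {W : Finset V}

theorem ncard_commonColors_topSwitching (hd : 0 < d) (hH : ∀ i, IsConeMinusFinite (H i))
    (hW : W.Nonempty) (m : V → Fin d → ℤ) :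
    ((commonColors (Φ.topSwitching B) (fun i => {c | c ∈ H i ∧ c ≤ m i}) W).ncard : ℝ) =
      Φ.componentCount H B W fun ik => m ik.1 ik.2 := by
  rw [commonColors_topSwitching hH hW, ncard_Icc_sdiff_eq_truncatedCount
    (finite_switchedHoles hd hH) fun c hc => (switchedApex_le_iff hW).2 hc.2]
  exact congrArg _ (funext fun k => (switchedTop_intCast hW m k).symm)

theorem holeTop_add_topSwitching_le_switchedTop [Fintype E] (hB : Φ.Balanced B)
    (hW : W ∈ Φ.parts B) {y : V × Fin d → ℝ} (hy : ∀ i k, (Φ.bound H i k : ℝ) ≤ y (i, k))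
    {j : V} (hj : j ∈ W) (k : Fin d) :
    (holeTop (H j) k : ℝ) + Φ.topSwitching B j k ≤ switchedTop (Φ.topSwitching B) W y k := by
  have : Nonempty W := (nonempty_of_mem_parts hW).to_subtype
  refine le_ciInf fun i => ?_
  have hbound : (holeTop (H j) k : ℝ) + Φ.topSwitching B j k ≤
      Φ.bound H i k + Φ.topSwitching B i k := by
    exact_mod_cast hB.holeTop_add_topSwitching_le H hW i.2 hj k
  exact hbound.trans (add_le_add_left (hy i k) _)

theorem componentCount_eq_of_bound_le [Fintype E] (hd : 0 < d)
    (hH : ∀ i, IsConeMinusFinite (H i)) (hB : Φ.Balanced B) (hW : W ∈ Φ.parts B)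
    {y : V × Fin d → ℝ} (hy : ∀ i k, (Φ.bound H i k : ℝ) ≤ y (i, k)) :
    Φ.componentCount H B W y = (∏ k, Φ.q H B W k y) - (Φ.switchedHoles H B W).ncard := by
  have hne := nonempty_of_mem_parts hW
  have : Nonempty W := hne.to_subtype
  have htop {j : V} (hj : j ∈ W) (k : Fin d) :=
    holeTop_add_topSwitching_le_switchedTop hB hW hy hj k
  rw [componentCount, truncatedCount_eq_prod_sub_ncard (finite_switchedHoles hd hH)]
  · simp only [q_eq_switchedTop_sub hne]
  · intro k
    rw [switchedApex_apply hne, sub_le_iff_le_add]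
    refine ciSup_le fun j => ?_
    have hapex : (apex (H j) k : ℝ) - 1 ≤ holeTop (H j) k := by
      exact_mod_cast (hH j).apex_sub_one_le_holeTop hd k
    linarith [htop j.2 k]
  · rintro _ ⟨⟨j, hj, a, ha, rfl⟩, -⟩ k
    have hhole : (a k : ℝ) ≤ holeTop (H j) k := by exact_mod_cast (hH j).le_holeTop hd ha k
    rw [Pi.add_apply, Int.cast_add]
    linarith [htop hj k]

variable [Fintype E]

theorem listChromatic_eq_realChromatic (hd : 0 < d) (hloop : ∀ e v, ¬ Φ.Step e v v 0)
    (hloose : ∀ e, Φ.edge e ≠ GainEdge.loose) (hH : ∀ i, IsConeMinusFinite (H i))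
    (m : V → Fin d → ℤ) :
    (Φ.listChromatic H m : ℝ) = Φ.realChromatic H fun ik => m ik.1 ik.2 := by
  have hcount := congrArg (Int.cast : ℤ → ℝ) (ncard_properColorings_eq_sum hloop hloose
    (fun B hB => hB.isPotential_topSwitching) (finite_setOf_mem_list_le hH m))
  push_cast at hcount
  refine hcount.trans (Finset.sum_congr rfl fun B _ => congrArg _ (Finset.prod_congr rfl ?_))
  exact fun W hW => ncard_commonColors_topSwitching hd hH (nonempty_of_mem_parts hW) m

theorem realChromatic_eq_p (hd : 0 < d) (hH : ∀ i, IsConeMinusFinite (H i))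
    {y : V × Fin d → ℝ} (hy : ∀ i k, (Φ.bound H i k : ℝ) ≤ y (i, k)) :
    Φ.realChromatic H y = Φ.p H y :=
  Finset.sum_congr rfl fun B _ => congrArg _ (Finset.prod_congr rfl fun _ hW =>
    componentCount_eq_of_bound_le hd hH B.2.1 hW hy)

end RealChromatic

end GainGraph

section Multiaffine

open MvPolynomial

variable {ι : Type*} (R : Type*) [CommRing R]

/-- The polynomials in the variables of `A` that have degree at most `1` in each variable and total
degree less than `n`. -/
noncomputable def multiaffineDegreeLT (A : Set ι) (n : ℕ) : Submodule R (MvPolynomial ι R) :=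
  restrictSupport R {s | ⇑s ≤ A.indicator 1 ∧ s.degree < n}

variable {R} {A A' : Set ι} {n n' : ℕ} {M M' P P' : MvPolynomial ι R}

theorem multiaffineDegreeLT_mono (hA : A ⊆ A') (hn : n ≤ n') :
    multiaffineDegreeLT R A n ≤ multiaffineDegreeLT R A' n' :=
  restrictSupport_mono R fun _ hs =>
    ⟨hs.1.trans (Set.indicator_le_indicator_of_subset hA fun _ => zero_le_one),
      hs.2.trans_le hn⟩

theorem degreeOf_le_one_of_mem_multiaffineDegreeLT (hP : P ∈ multiaffineDegreeLT R A n) (i : ι) :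
    P.degreeOf i ≤ 1 := by
  rw [degreeOf_eq_sup]
  refine Finset.sup_le fun s hs => ((hP hs).1 i).trans ?_
  exact Set.indicator_le_self' (fun _ _ => zero_le_one) i

theorem C_mem_multiaffineDegreeLT (hn : 0 < n) (c : R) : C c ∈ multiaffineDegreeLT R A n :=
  (monomial_mem_restrictSupport R).2 (Or.inl
    ⟨fun i => Nat.zero_le _, by rwa [map_zero]⟩)

theorem X_mem_multiaffineDegreeLT {i : ι} (hi : i ∈ A) : X i ∈ multiaffineDegreeLT R A 2 := by
  classical
  refine (monomial_mem_restrictSupport R).2 (Or.inl ⟨fun j => ?_, ?_⟩)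
  · rw [Finsupp.single_apply]
    split_ifs with hij
    · rw [Set.indicator_of_mem (hij ▸ hi), Pi.one_apply]
    · exact Nat.zero_le _
  · rw [Finsupp.degree_single]
    exact one_lt_two

theorem mul_mem_multiaffineDegreeLT (hA : Disjoint A A')
    (hP : P ∈ multiaffineDegreeLT R A (n + 1)) (hP' : P' ∈ multiaffineDegreeLT R A' n') :
    P * P' ∈ multiaffineDegreeLT R (A ∪ A') (n + n') := by
  have hmul := Submodule.mul_mem_mul hP hP'
  rw [multiaffineDegreeLT, multiaffineDegreeLT, ← restrictSupport_add] at hmul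
  refine restrictSupport_mono R ?_ hmul
  rintro _ ⟨s, ⟨hs, hsn⟩, t, ⟨ht, htn⟩, rfl⟩
  refine ⟨?_, ?_⟩
  · rw [Set.indicator_union_of_disjoint hA]
    exact add_le_add hs ht
  · rw [map_add]
    omega

/-- `P` is a multiaffine polynomial in the variables of `A` that consists of `M`, of total degree at
most `n`, and terms of total degree less than `n`. -/
def HasLeadingPart (A : Set ι) (n : ℕ) (M P : MvPolynomial ι R) : Prop :=
  M ∈ multiaffineDegreeLT R A (n + 1) ∧ P - M ∈ multiaffineDegreeLT R A n

namespace HasLeadingPart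

theorem mem (h : HasLeadingPart A n M P) : P ∈ multiaffineDegreeLT R A (n + 1) := by
  rw [← sub_add_cancel P M]
  exact add_mem (multiaffineDegreeLT_mono le_rfl n.le_succ h.2) h.1

theorem add (h : HasLeadingPart A n M P) (hP' : P' ∈ multiaffineDegreeLT R A n) :
    HasLeadingPart A n M (P + P') :=
  ⟨h.1, by simpa only [add_sub_right_comm] using add_mem h.2 hP'⟩

theorem X_add_C {i : ι} (hi : i ∈ A) (c : R) : HasLeadingPart A 1 (X i) (X i + C c) :=
  ⟨X_mem_multiaffineDegreeLT hi,
    by simpa only [add_sub_cancel_left] using C_mem_multiaffineDegreeLT zero_lt_one c⟩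

theorem mul (hA : Disjoint A A') (h : HasLeadingPart A n M P) (h' : HasLeadingPart A' n' M' P') :
    HasLeadingPart (A ∪ A') (n + n') (M * M') (P * P') := by
  refine ⟨mul_mem_multiaffineDegreeLT (n' := n' + 1) hA h.1 h'.1, ?_⟩
  rw [show P * P' - M * M' = P * (P' - M') + M' * (P - M) by ring]
  refine add_mem (mul_mem_multiaffineDegreeLT hA h.mem h'.2) ?_
  rw [Set.union_comm, add_comm n]
  exact mul_mem_multiaffineDegreeLT hA.symm h'.1 h.2

theorem prod {κ : Type*} {s : Finset κ} {A : κ → Set ι} (hA : (s : Set κ).PairwiseDisjoint A)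
    {n : κ → ℕ} {M P : κ → MvPolynomial ι R} (h : ∀ a ∈ s, HasLeadingPart (A a) (n a) (M a) (P a)) :
    HasLeadingPart (⋃ a ∈ s, A a) (∑ a ∈ s, n a) (∏ a ∈ s, M a) (∏ a ∈ s, P a) := by
  classical
  induction s using Finset.induction_on with
  | empty =>
    simp only [Finset.prod_empty, HasLeadingPart, sub_self, zero_mem, and_true]
    exact C_mem_multiaffineDegreeLT (Nat.succ_pos _) 1
  | insert a s ha ih =>
    rw [Finset.coe_insert, Set.pairwiseDisjoint_insert_of_notMem ha] at hA
    rw [Finset.set_biUnion_insert, Finset.sum_insert ha, Finset.prod_insert ha,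
      Finset.prod_insert ha]
    exact (h a (Finset.mem_insert_self a s)).mul (Set.disjoint_iUnion₂_right.2 hA.2)
      (ih hA.1 fun b hb => h b (Finset.mem_insert_of_mem hb))

theorem isMonicMultilinear [Fintype ι] {P : MvPolynomial ι ℝ}
    (h : HasLeadingPart A (Fintype.card ι) (∏ i, X i) P) : IsMonicMultilinear P :=
  fun _ hs => (h.2 hs).2

end HasLeadingPart

theorem prod_mem_multiaffineDegreeLT {κ : Type*} {s : Finset κ} {A : κ → Set ι}
    (hA : (s : Set κ).PairwiseDisjoint A) {n : κ → ℕ} {P : κ → MvPolynomial ι R}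
    (hP : ∀ a ∈ s, P a ∈ multiaffineDegreeLT R (A a) (n a + 1)) :
    ∏ a ∈ s, P a ∈ multiaffineDegreeLT R (⋃ a ∈ s, A a) (∑ a ∈ s, n a + 1) :=
  (HasLeadingPart.prod (P := P) hA fun a ha => ⟨hP a ha, by simp only [sub_self, zero_mem]⟩).1

end Multiaffine

section ContinuousSelection

open MvPolynomial
open scoped Pointwise

variable {ι : Type*}

/-- `f` is continuous and agrees at each point with one of finitely many members of `𝓟`. -/
def IsContinuousSelection (𝓟 : Set (MvPolynomial ι ℝ)) (f : (ι → ℝ) → ℝ) : Prop :=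
  Continuous f ∧ ∃ 𝓕 ⊆ 𝓟, 𝓕.Finite ∧ ∀ y, ∃ P ∈ 𝓕, f y = eval y P

namespace IsContinuousSelection

variable {𝓟 𝓠 : Set (MvPolynomial ι ℝ)} {f g : (ι → ℝ) → ℝ}

theorem of_eval {P : MvPolynomial ι ℝ} (hP : P ∈ 𝓟) :
    IsContinuousSelection 𝓟 fun y => eval y P :=
  ⟨P.continuous_eval, {P}, Set.singleton_subset_iff.2 hP, Set.finite_singleton P,
    fun _ => ⟨P, rfl, rfl⟩⟩

theorem mono (h : IsContinuousSelection 𝓟 f) (hsub : 𝓟 ⊆ 𝓠) : IsContinuousSelection 𝓠 f := by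
  obtain ⟨hf, 𝓕, h𝓕, hfin, hsel⟩ := h
  exact ⟨hf, 𝓕, h𝓕.trans hsub, hfin, hsel⟩

theorem of_forall_exists_eq {κ : Type*} [Finite κ] {F : κ → (ι → ℝ) → ℝ}
    (hF : ∀ a, IsContinuousSelection 𝓟 (F a)) (hf : Continuous f) (h : ∀ y, ∃ a, f y = F a y) :
    IsContinuousSelection 𝓟 f := by
  choose _ 𝓕 h𝓕 hfin hsel using hF
  refine ⟨hf, ⋃ a, 𝓕 a, Set.iUnion_subset h𝓕, Set.finite_iUnion hfin, fun y => ?_⟩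
  obtain ⟨a, ha⟩ := h y
  obtain ⟨P, hP, hy⟩ := hsel a y
  exact ⟨P, Set.mem_iUnion.2 ⟨a, hP⟩, ha.trans hy⟩

theorem ciInf {κ : Type*} [Finite κ] [Nonempty κ] {F : κ → (ι → ℝ) → ℝ}
    (hF : ∀ a, IsContinuousSelection 𝓟 (F a)) : IsContinuousSelection 𝓟 fun y => ⨅ a, F a y := by
  have := Fintype.ofFinite κ
  refine of_forall_exists_eq hF ?_ fun y => ?_
  · simp only [← Finset.inf'_univ_eq_ciInf]
    exact Continuous.finset_inf'_apply _ fun a _ => (hF a).1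
  · obtain ⟨a, ha⟩ := exists_eq_ciInf_of_finite (f := fun a => F a y)
    exact ⟨a, ha.symm⟩

theorem max (hf : IsContinuousSelection 𝓟 f) (hg : IsContinuousSelection 𝓟 g) :
    IsContinuousSelection 𝓟 fun y => max (f y) (g y) :=
  of_forall_exists_eq (F := Bool.rec g f) (Bool.rec hg hf) (hf.1.max hg.1) fun y =>
    (max_choice (f y) (g y)).elim (fun h => ⟨true, h⟩) fun h => ⟨false, h⟩

theorem min (hf : IsContinuousSelection 𝓟 f) (hg : IsContinuousSelection 𝓟 g) :
    IsContinuousSelection 𝓟 fun y => min (f y) (g y) :=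
  of_forall_exists_eq (F := Bool.rec g f) (Bool.rec hg hf) (hf.1.min hg.1) fun y =>
    (min_choice (f y) (g y)).elim (fun h => ⟨true, h⟩) fun h => ⟨false, h⟩

theorem add (hf : IsContinuousSelection 𝓟 f) (hg : IsContinuousSelection 𝓠 g) :
    IsContinuousSelection (𝓟 + 𝓠) fun y => f y + g y := by
  obtain ⟨hfc, 𝓕, h𝓕, hfin, hsel⟩ := hf
  obtain ⟨hgc, 𝓖, h𝓖, hfin', hsel'⟩ := hg
  refine ⟨hfc.add hgc, 𝓕 + 𝓖, Set.add_subset_add h𝓕 h𝓖, hfin.add hfin', fun y => ?_⟩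
  obtain ⟨P, hP, hy⟩ := hsel y
  obtain ⟨Q, hQ, hy'⟩ := hsel' y
  exact ⟨P + Q, Set.add_mem_add hP hQ, by simp only [map_add, hy, hy']⟩

theorem mul (hf : IsContinuousSelection 𝓟 f) (hg : IsContinuousSelection 𝓠 g) :
    IsContinuousSelection (𝓟 * 𝓠) fun y => f y * g y := by
  obtain ⟨hfc, 𝓕, h𝓕, hfin, hsel⟩ := hf
  obtain ⟨hgc, 𝓖, h𝓖, hfin', hsel'⟩ := hg
  refine ⟨hfc.mul hgc, 𝓕 * 𝓖, Set.mul_subset_mul h𝓕 h𝓖, hfin.mul hfin', fun y => ?_⟩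
  obtain ⟨P, hP, hy⟩ := hsel y
  obtain ⟨Q, hQ, hy'⟩ := hsel' y
  exact ⟨P * Q, Set.mul_mem_mul hP hQ, by simp only [map_mul, hy, hy']⟩

theorem prod {κ : Type*} {s : Finset κ} {𝓟 : κ → Set (MvPolynomial ι ℝ)}
    {F : κ → (ι → ℝ) → ℝ} (hF : ∀ a ∈ s, IsContinuousSelection (𝓟 a) (F a)) :
    IsContinuousSelection (∏ a ∈ s, 𝓟 a) fun y => ∏ a ∈ s, F a y := by
  classical
  induction s using Finset.induction_on with
  | empty => simpa only [Finset.prod_empty, map_one] using of_eval (Set.mem_one.2 rfl)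
  | insert a s ha ih =>
    simp only [Finset.prod_insert ha]
    exact (hF a (Finset.mem_insert_self a s)).mul
      (ih fun b hb => hF b (Finset.mem_insert_of_mem hb))

section Submodule

variable {M : Submodule ℝ (MvPolynomial ι ℝ)}

theorem add_mem (hf : IsContinuousSelection M f) (hg : IsContinuousSelection M g) :
    IsContinuousSelection M fun y => f y + g y :=
  (hf.add hg).mono (Set.add_subset_iff.2 fun _ hP _ hQ => M.add_mem hP hQ)

theorem const_mul (hf : IsContinuousSelection M f) (c : ℝ) :
    IsContinuousSelection M fun y => c * f y := by
  have h := (of_eval (Set.mem_singleton (C c))).mul hf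
  simp only [eval_C] at h
  refine h.mono (Set.mul_subset_iff.2 fun _ hC P hP => ?_)
  rw [Set.mem_singleton_iff.1 hC, C_mul']
  exact M.smul_mem c hP

theorem sub (hf : IsContinuousSelection M f) (hg : IsContinuousSelection M g) :
    IsContinuousSelection M fun y => f y - g y := by
  simpa only [sub_eq_add_neg, neg_one_mul] using hf.add_mem (hg.const_mul (-1))

theorem sum {κ : Type*} {s : Finset κ} {F : κ → (ι → ℝ) → ℝ}
    (hF : ∀ a ∈ s, IsContinuousSelection M (F a)) :
    IsContinuousSelection M fun y => ∑ a ∈ s, F a y := by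
  classical
  induction s using Finset.induction_on with
  | empty => simpa only [Finset.sum_empty, map_zero] using of_eval M.zero_mem
  | insert a s ha ih =>
    simp only [Finset.sum_insert ha]
    exact (hF a (Finset.mem_insert_self a s)).add_mem
      (ih fun b hb => hF b (Finset.mem_insert_of_mem hb))

end Submodule

theorem prod_multiaffineDegreeLT {κ : Type*} {s : Finset κ} {A : κ → Set ι}
    (hA : (s : Set κ).PairwiseDisjoint A) {n : κ → ℕ} {F : κ → (ι → ℝ) → ℝ}
    (hF : ∀ a ∈ s, IsContinuousSelection (multiaffineDegreeLT ℝ (A a) (n a + 1)) (F a)) :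
    IsContinuousSelection (multiaffineDegreeLT ℝ (⋃ a ∈ s, A a) (∑ a ∈ s, n a + 1))
      fun y => ∏ a ∈ s, F a y := by
  refine (prod hF).mono fun Q hQ => ?_
  obtain ⟨P, hP, rfl⟩ := (Set.mem_finsetProd _ _ _).1 hQ
  exact prod_mem_multiaffineDegreeLT hA fun a ha => hP ha

end IsContinuousSelection

end ContinuousSelection

section ContinuousSelectionExamples

open MvPolynomial

variable {ι κ : Type*} [Fintype κ] {A : κ → Set ι}

theorem isContinuousSelection_const {A : Set ι} {n : ℕ} (hn : 0 < n) (c : ℝ) :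
    IsContinuousSelection (ι := ι) (multiaffineDegreeLT ℝ A n) fun _ => c := by
  simpa only [eval_C] using IsContinuousSelection.of_eval
    (SetLike.mem_coe.2 (C_mem_multiaffineDegreeLT hn c))

theorem isContinuousSelection_prod_univ (hA : Pairwise (Function.onFun Disjoint A))
    {F : κ → (ι → ℝ) → ℝ}
    (hF : ∀ k, IsContinuousSelection (multiaffineDegreeLT ℝ (A k) 2) (F k)) :
    IsContinuousSelection (multiaffineDegreeLT ℝ (⋃ k, A k) (Fintype.card κ + 1))
      fun y => ∏ k, F k y := by
  simpa only [Finset.mem_univ, Set.iUnion_true, Finset.sum_const, Finset.card_univ, smul_eq_mul,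
    mul_one] using IsContinuousSelection.prod_multiaffineDegreeLT (s := Finset.univ)
      (n := fun _ => 1) (hA.set_pairwise _) fun k _ => hF k

variable {t : (ι → ℝ) → κ → ℝ}

theorem isContinuousSelection_prod_sub_const (hA : Pairwise (Function.onFun Disjoint A))
    (ht : ∀ k, IsContinuousSelection (multiaffineDegreeLT ℝ (A k) 2) fun y => t y k)
    (a : κ → ℝ) (c : ℝ) :
    IsContinuousSelection (multiaffineDegreeLT ℝ (⋃ k, A k) (Fintype.card κ + 1))
      fun y => ∏ k, (t y k - a k + 1) - c :=
  (isContinuousSelection_prod_univ hA fun k =>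
    ((ht k).sub (isContinuousSelection_const two_pos _)).add_mem
      (isContinuousSelection_const two_pos 1)).sub
    (isContinuousSelection_const (Nat.succ_pos _) c)

theorem isContinuousSelection_truncatedCount (hA : Pairwise (Function.onFun Disjoint A))
    (ht : ∀ k, IsContinuousSelection (multiaffineDegreeLT ℝ (A k) 2) fun y => t y k)
    (a : κ → ℤ) {S : Set (κ → ℤ)} (hS : S.Finite) :
    IsContinuousSelection (multiaffineDegreeLT ℝ (⋃ k, A k) (Fintype.card κ + 1))
      fun y => truncatedCount a S (t y) := by
  have hconst (k : κ) (c : ℝ) :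
      IsContinuousSelection (ι := ι) (multiaffineDegreeLT ℝ (A k) 2) fun _ => c :=
    isContinuousSelection_const two_pos c
  have hside (k : κ) (c : ℤ) :
      IsContinuousSelection (multiaffineDegreeLT ℝ (A k) 2) fun y => t y k - c + 1 :=
    ((ht k).sub (hconst k c)).add_mem (hconst k 1)
  simp only [truncatedCount, finsum_mem_eq_finite_toFinset_sum _ hS]
  exact (isContinuousSelection_prod_univ hA fun k => (hside k (a k)).max (hconst k 0)).sub
    (IsContinuousSelection.sum fun c _ => isContinuousSelection_prod_univ hA fun k =>
      (hconst k 0).max ((hconst k 1).min (hside k (c k))))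

end ContinuousSelectionExamples

section Pieces

open MvPolynomial

variable {ι : Type*}

/-- The set of points at which `f` agrees with the polynomial `P`. -/
def agreementSet (f : (ι → ℝ) → ℝ) (P : MvPolynomial ι ℝ) : Set (ι → ℝ) :=
  {y | f y = eval y P}

variable {f : (ι → ℝ) → ℝ}

theorem isClosed_agreementSet (hf : Continuous f) (P : MvPolynomial ι ℝ) :
    IsClosed (agreementSet f P) :=
  isClosed_eq hf P.continuous_eval

theorem subset_closure_iUnion_interior_agreementSet [Finite ι] (hf : Continuous f)
    {𝓕 : Set (MvPolynomial ι ℝ)} (h𝓕 : 𝓕.Finite) {U : Set (ι → ℝ)} (hU : IsOpen U)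
    (hsel : ∀ y ∈ U, ∃ P ∈ 𝓕, f y = eval y P) :
    U ⊆ closure (⋃ P ∈ 𝓕, interior (agreementSet f P)) := by
  have : Finite 𝓕 := h𝓕
  have hdense := dense_iUnion_interior_of_closed
    (f := fun P : Option 𝓕 => P.elim Uᶜ fun P => agreementSet f P)
    (Option.rec hU.isClosed_compl fun P => isClosed_agreementSet hf P) (by
      refine Set.eq_univ_iff_forall.2 fun y => ?_
      by_cases hy : y ∈ U
      · obtain ⟨P, hP, hyP⟩ := hsel y hy
        exact Set.mem_iUnion.2 ⟨some ⟨P, hP⟩, hyP⟩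
      · exact Set.mem_iUnion.2 ⟨none, hy⟩)
  refine fun y hy => mem_closure_iff.2 fun o ho hyo => ?_
  obtain ⟨z, ⟨hzU, hzo⟩, hz⟩ := hdense.inter_open_nonempty _ (hU.inter ho) ⟨y, hy, hyo⟩
  obtain ⟨_ | P, hP⟩ := Set.mem_iUnion.1 hz
  · exact absurd hzU (interior_subset hP)
  · exact ⟨z, hzo, Set.mem_biUnion P.2 hP⟩

theorem exists_hasPieces (hf : Continuous f) {𝓣 : Set (MvPolynomial ι ℝ)} (h𝓣 : 𝓣.Finite)
    (hne : ∀ P ∈ 𝓣, (interior (agreementSet f P)).Nonempty)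
    (hcover : Dense (⋃ P ∈ 𝓣, interior (agreementSet f P))) :
    ∃ (N : ℕ) (D : Fin N → Set (ι → ℝ)) (P : Fin N → MvPolynomial ι ℝ),
      HasPieces f D P ∧ Set.range P = 𝓣 := by
  have : Finite 𝓣 := h𝓣
  obtain ⟨N, ⟨e⟩⟩ := Finite.exists_equiv_fin 𝓣
  refine ⟨N, fun σ => closure (interior (agreementSet f (e.symm σ))), fun σ => (e.symm σ).1,
    ⟨fun σ => ⟨isClosed_closure, (hne _ (e.symm σ).2).closure, ?_⟩, ?_, fun σ y hy => ?_⟩, ?_⟩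
  · exact closure_mono (interior_maximal subset_closure isOpen_interior)
  · rw [e.symm.surjective.iUnion_comp fun P => closure (interior (agreementSet f P.1)),
      ← closure_iUnion_of_finite, ← dense_iff_closure_eq, Set.iUnion_coe_set]
    exact hcover
  · exact closure_minimal interior_subset (isClosed_agreementSet hf _) hy
  · exact (e.symm.surjective.range_comp Subtype.val).trans Subtype.range_coe

variable [Fintype ι]

theorem IsContinuousSelection.isPiecewisePolynomialWithLeadingProd
    (hf : IsContinuousSelection {P | ∀ i, P.degreeOf i ≤ 1} f) {P : MvPolynomial ι ℝ}
    (hmonic : IsMonicMultilinear P) (hdeg : ∀ i, P.degreeOf i ≤ 1)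
    (hP : (interior (agreementSet f P)).Nonempty) : IsPiecewisePolynomialWithLeadingProd f := by
  obtain ⟨hfc, 𝓕, h𝓕, hfin, hsel⟩ := hf
  obtain ⟨N, D, Q, hpieces, hQ⟩ := exists_hasPieces hfc
    (𝓣 := {Q ∈ insert P 𝓕 | (interior (agreementSet f Q)).Nonempty})
    ((hfin.insert P).subset (Set.sep_subset _ _)) (fun _ h => h.2) (by
      refine dense_iff_closure_eq.2 (Set.univ_subset_iff.1 ?_)
      refine (subset_closure_iUnion_interior_agreementSet hfc hfin isOpen_univ
        fun y _ => hsel y).trans (closure_mono (Set.iUnion₂_subset fun Q hQ z hz => ?_))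
      exact Set.mem_biUnion ⟨Or.inr hQ, ⟨z, hz⟩⟩ hz)
  refine ⟨N, D, Q, hpieces, ?_, fun σ => ?_⟩
  · obtain ⟨σ, hσ⟩ : P ∈ Set.range Q := hQ ▸ ⟨Set.mem_insert P 𝓕, hP⟩
    exact ⟨σ, hσ ▸ hmonic⟩
  · have hσ : Q σ ∈ insert P 𝓕 := (hQ ▸ Set.mem_range_self σ : Q σ ∈ {Q ∈ insert P 𝓕 | _}).1
    rcases hσ with hσ | hσ
    · exact hσ ▸ hdeg
    · exact h𝓕 hσ

theorem IsContinuousSelection.isPiecewisePolynomialWithLeadingProd_of_eqOn {n : ℕ}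
    {g : (ι → ℝ) → ℝ} (hf : IsContinuousSelection (multiaffineDegreeLT ℝ (Set.univ : Set ι) n) f)
    (hg : IsContinuousSelection
      {P | HasLeadingPart Set.univ (Fintype.card ι) (∏ i, X i) P} g)
    {U : Set (ι → ℝ)} (hU : IsOpen U) (hne : U.Nonempty) (hfg : Set.EqOn f g U) :
    IsPiecewisePolynomialWithLeadingProd f := by
  obtain ⟨-, 𝓖, h𝓖, hfin, hsel⟩ := hg
  obtain ⟨P, hP, hint⟩ : ∃ P ∈ 𝓖, (interior (agreementSet f P)).Nonempty := by
    have hclosure := hne.mono (subset_closure_iUnion_interior_agreementSet hf.1 hfin hU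
      fun y hy => (hsel y).imp fun P hP => ⟨hP.1, (hfg hy).trans hP.2⟩)
    obtain ⟨y, hy⟩ := closure_nonempty_iff.1 hclosure
    obtain ⟨P, hP, hyP⟩ := Set.mem_iUnion₂.1 hy
    exact ⟨P, hP, y, hyP⟩
  exact (hf.mono fun _ hQ => degreeOf_le_one_of_mem_multiaffineDegreeLT
    hQ).isPiecewisePolynomialWithLeadingProd (h𝓖 hP).isMonicMultilinear
      (degreeOf_le_one_of_mem_multiaffineDegreeLT (h𝓖 hP).mem) hint

end Pieces

theorem pairwise_disjoint_prod_singleton {α β : Type*} (A : Set α) :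
    Pairwise (Function.onFun Disjoint fun b : β => A ×ˢ ({b} : Set β)) := fun _ _ hbc =>
  Set.disjoint_prod.2 (Or.inr (Set.disjoint_singleton.2 hbc))

namespace GainGraph

section Selections

open MvPolynomial

variable {V E : Type*} {d : ℕ}

theorem isContinuousSelection_switchedTop {W : Finset V} (hW : W.Nonempty) (η : V → Fin d → ℤ)
    (k : Fin d) :
    IsContinuousSelection (multiaffineDegreeLT ℝ ((W : Set V) ×ˢ {k}) 2)
      fun y => switchedTop η W y k := by
  have : Nonempty W := hW.to_subtype
  refine IsContinuousSelection.ciInf fun i : W => ?_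
  simpa only [map_add, eval_X, eval_C] using IsContinuousSelection.of_eval
    (HasLeadingPart.X_add_C (A := (W : Set V) ×ˢ {k}) (i := (i.1, k)) ⟨i.2, rfl⟩ (η i k : ℝ)).mem

variable [Fintype V] {Φ : GainGraph V E (Fin d → ℤ)} {H : V → Set (Fin d → ℤ)} {B : Finset E}
  {W : Finset V}

theorem isContinuousSelection_componentCount (hd : 0 < d) (hH : ∀ i, IsConeMinusFinite (H i))
    (hW : W.Nonempty) :
    IsContinuousSelection
      (multiaffineDegreeLT ℝ ((W : Set V) ×ˢ (Set.univ : Set (Fin d))) (d + 1))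
      (Φ.componentCount H B W) := by
  have h := isContinuousSelection_truncatedCount (pairwise_disjoint_prod_singleton (W : Set V))
    (isContinuousSelection_switchedTop hW (Φ.topSwitching B))
    (switchedApex H (Φ.topSwitching B) W) (finite_switchedHoles (Φ := Φ) (B := B) (W := W) hd hH)
  rwa [← Set.prod_iUnion, Set.iUnion_of_singleton, Fintype.card_fin] at h

theorem isContinuousSelection_prod_q_sub (hW : W.Nonempty) (c : ℝ) :
    IsContinuousSelection
      (multiaffineDegreeLT ℝ ((W : Set V) ×ˢ (Set.univ : Set (Fin d))) (d + 1))
      fun y => (∏ k, Φ.q H B W k y) - c := by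
  have h := isContinuousSelection_prod_sub_const (pairwise_disjoint_prod_singleton (W : Set V))
    (isContinuousSelection_switchedTop hW (Φ.topSwitching B))
    (fun k => switchedApex H (Φ.topSwitching B) W k) c
  rw [← Set.prod_iUnion, Set.iUnion_of_singleton, Fintype.card_fin] at h
  simpa only [q_eq_switchedTop_sub hW] using h

theorem pairwiseDisjoint_parts : (Φ.parts B : Set (Finset V)).PairwiseDisjoint id := by
  refine fun W hW W' hW' hne => Finset.disjoint_left.2 fun u hu hu' => hne ?_
  rw [← component_eq_of_mem_parts hW hu, component_eq_of_mem_parts hW' hu']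

theorem isContinuousSelection_prod_parts {F : Finset V → (V × Fin d → ℝ) → ℝ}
    (hF : ∀ W ∈ Φ.parts B, IsContinuousSelection
      (multiaffineDegreeLT ℝ ((W : Set V) ×ˢ (Set.univ : Set (Fin d))) (d + 1)) (F W)) :
    IsContinuousSelection
      (multiaffineDegreeLT ℝ (Set.univ : Set (V × Fin d)) ((Φ.parts B).card * d + 1))
      fun y => ∏ W ∈ Φ.parts B, F W y := by
  have hdisj : (Φ.parts B : Set (Finset V)).PairwiseDisjoint
      fun W => (W : Set V) ×ˢ (Set.univ : Set (Fin d)) := fun W hW W' hW' hne =>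
    Set.disjoint_prod.2 (Or.inl (Finset.disjoint_coe.2 (pairwiseDisjoint_parts hW hW' hne)))
  refine (IsContinuousSelection.prod_multiaffineDegreeLT hdisj (n := fun _ => d) hF).mono ?_
  rw [Finset.sum_const, smul_eq_mul]
  exact multiaffineDegreeLT_mono (Set.subset_univ _) le_rfl

theorem isContinuousSelection_realChromatic [Fintype E] (hd : 0 < d)
    (hH : ∀ i, IsConeMinusFinite (H i)) :
    IsContinuousSelection
      (multiaffineDegreeLT ℝ (Set.univ : Set (V × Fin d)) (Fintype.card V * d + 1))
      (Φ.realChromatic H) := by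
  classical
  refine IsContinuousSelection.sum fun B _ => IsContinuousSelection.const_mul
    ((isContinuousSelection_prod_parts fun W hW => isContinuousSelection_componentCount hd hH
      (nonempty_of_mem_parts hW)).mono (multiaffineDegreeLT_mono le_rfl ?_)) _
  exact Nat.succ_le_succ (Nat.mul_le_mul_right d Finset.card_image_le)

end Selections

section LeadingTerm

open MvPolynomial

variable {V E : Type*} [Fintype V] {d : ℕ} {Φ : GainGraph V E (Fin d → ℤ)}
  {H : V → Set (Fin d → ℤ)} {B : Finset E}

theorem card_parts_lt (hloop : ∀ e v, ¬ Φ.Step e v v 0)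
    (hloose : ∀ e, Φ.edge e ≠ GainEdge.loose) (hB : Φ.Balanced B) (hne : B ≠ ∅) :
    (Φ.parts B).card < Fintype.card V := by
  obtain ⟨e, he⟩ := Finset.nonempty_iff_ne_empty.2 hne
  obtain ⟨u, v, g, hstep⟩ := exists_step (hB.1 e he) (hloose e)
  have huv : u ≠ v := by
    rintro rfl
    exact hloop e u (hB.closed_walk_eq_zero (Walk.single he hstep) ▸ hstep)
  classical
  refine Finset.card_image_le.lt_of_ne fun hcard => huv ?_
  exact Finset.card_image_iff.1 hcard (Finset.mem_coe.2 (Finset.mem_univ u))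
    (Finset.mem_coe.2 (Finset.mem_univ v)) (hstep.component_eq he).symm

theorem component_empty (i : V) : Φ.component ∅ i = {i} := by
  ext j
  rw [mem_component, Finset.mem_singleton]
  constructor
  · rintro ⟨l, g, hwalk⟩
    cases hwalk with
    | nil => rfl
    | cons he => exact absurd he (Finset.notMem_empty _)
  · rintro rfl
    exact ⟨_, _, Walk.nil j⟩

theorem prod_parts_empty {M : Type*} [CommMonoid M] (F : Finset V → M) :
    ∏ W ∈ Φ.parts ∅, F W = ∏ i, F {i} := by
  classical
  have hparts : Φ.parts ∅ = Finset.univ.image fun i => ({i} : Finset V) := by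
    ext W
    simp only [mem_parts, component_empty, Finset.mem_image, Finset.mem_univ, true_and]
  rw [hparts, Finset.prod_image Finset.singleton_injective.injOn]

theorem exists_hasLeadingPart_prod_q_sub (hd : 0 < d) (i : V) (c : ℝ) :
    ∃ P, HasLeadingPart ({i} ×ˢ Set.univ) d (∏ k, X (i, k)) P ∧
      ∀ y, (∏ k, Φ.q H B {i} k y) - c = eval y P := by
  have hlead := HasLeadingPart.prod (s := Finset.univ)
    (A := fun k : Fin d => ({i} : Set V) ×ˢ ({k} : Set (Fin d))) (n := fun _ => 1)
    ((pairwise_disjoint_prod_singleton {i}).set_pairwise _)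
    fun k _ => HasLeadingPart.X_add_C (i := (i, k))
      (Set.mk_mem_prod (Set.mem_singleton i) (Set.mem_singleton k)) (1 - (apex (H i) k : ℝ))
  simp only [Finset.mem_univ, Set.iUnion_true, ← Set.prod_iUnion, Set.iUnion_of_singleton,
    Finset.sum_const, Finset.card_fin, smul_eq_mul, mul_one] at hlead
  refine ⟨_, hlead.add (C_mem_multiaffineDegreeLT hd (-c)), fun y => ?_⟩
  have hq (k : Fin d) : Φ.q H B {i} k y = y (i, k) + (1 - apex (H i) k) := by
    rw [q, ciInf_unique, ciSup_unique]
    simp only [Finset.default_singleton]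
    ring
  simp only [hq, map_add, map_prod, eval_X, eval_C, sub_eq_add_neg]

theorem exists_hasLeadingPart_prod_parts_empty (hd : 0 < d) (c : Finset V → ℝ) :
    ∃ P, HasLeadingPart Set.univ (Fintype.card (V × Fin d)) (∏ ik : V × Fin d, X ik) P ∧
      ∀ y, ∏ W ∈ Φ.parts ∅, ((∏ k, Φ.q H ∅ W k y) - c W) = eval y P := by
  choose P hP heval using fun i : V =>
    exists_hasLeadingPart_prod_q_sub (Φ := Φ) (H := H) (B := ∅) hd i (c {i})
  have hdisj : ((Finset.univ : Finset V) : Set V).PairwiseDisjoint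
      fun i => ({i} : Set V) ×ˢ (Set.univ : Set (Fin d)) := fun i _ j _ hij =>
    Set.disjoint_prod.2 (Or.inl (Set.disjoint_singleton.2 hij))
  have hlead := HasLeadingPart.prod hdisj fun i _ => hP i
  simp only [Finset.mem_univ, Set.iUnion_true, ← Set.iUnion_prod_const, Set.iUnion_of_singleton,
    Set.univ_prod_univ, Finset.sum_const, Finset.card_univ, smul_eq_mul,
    ← Fintype.prod_prod_type (f := fun ik : V × Fin d => X (R := ℝ) ik)] at hlead
  refine ⟨_, by rwa [Fintype.card_prod, Fintype.card_fin], fun y => ?_⟩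
  rw [prod_parts_empty, map_prod]
  exact Finset.prod_congr rfl fun i _ => heval i y

theorem isContinuousSelection_p [Fintype E] (hd : 0 < d) (hloop : ∀ e v, ¬ Φ.Step e v v 0)
    (hloose : ∀ e, Φ.edge e ≠ GainEdge.loose) :
    IsContinuousSelection
      {P | HasLeadingPart Set.univ (Fintype.card (V × Fin d)) (∏ ik : V × Fin d, X ik) P}
      (Φ.p H) := by
  classical
  let B₀ : Φ.Latb := ⟨∅, balanced_closed_empty hloop hloose⟩
  obtain ⟨P, hP, heval⟩ := exists_hasLeadingPart_prod_parts_empty (Φ := Φ) (H := H) hd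
    fun W => ((Φ.switchedHoles H ∅ W).ncard : ℝ)
  have hlower : IsContinuousSelection
      (multiaffineDegreeLT ℝ (Set.univ : Set (V × Fin d)) (Fintype.card (V × Fin d))) fun y =>
        ∑ B ∈ Finset.univ.erase B₀, (Φ.muEmpty B : ℝ) *
          ∏ W ∈ Φ.parts B.1, ((∏ k, Φ.q H B.1 W k y) - ((Φ.switchedHoles H B.1 W).ncard : ℝ)) := by
    refine IsContinuousSelection.sum fun B hB => IsContinuousSelection.const_mul
      ((isContinuousSelection_prod_parts fun W hW => isContinuousSelection_prod_q_sub
        (nonempty_of_mem_parts hW) _).mono (multiaffineDegreeLT_mono le_rfl ?_)) _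
    rw [Fintype.card_prod, Fintype.card_fin]
    exact Nat.mul_lt_mul_of_pos_right (card_parts_lt hloop hloose B.2.1 fun h =>
      Finset.ne_of_mem_erase hB (Subtype.ext h)) hd
  have hp : Φ.p H = fun y => eval y P + _ := funext fun y => by
    rw [p, ← Finset.add_sum_erase _ _ (Finset.mem_univ B₀), muEmpty_empty, Int.cast_one, one_mul,
      heval]
  rw [hp]
  refine ((IsContinuousSelection.of_eval (Set.mem_singleton P)).add hlower).mono ?_
  rintro _ ⟨_, rfl, Q, hQ, rfl⟩
  exact hP.add hQ

end LeadingTerm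

end GainGraph

namespace GainGraph

section Piecewise

variable {V E : Type*} [Fintype V] [Fintype E] {d : ℕ} {Φ : GainGraph V E (Fin d → ℤ)}
  {H : V → Set (Fin d → ℤ)}

theorem isPiecewisePolynomialWithLeadingProd_p (hd : 0 < d) (hloop : ∀ e v, ¬ Φ.Step e v v 0)
    (hloose : ∀ e, Φ.edge e ≠ GainEdge.loose) :
    IsPiecewisePolynomialWithLeadingProd (Φ.p H) := by
  have hp := isContinuousSelection_p (H := H) hd hloop hloose
  exact (hp.mono fun _ hP => hP.mem).isPiecewisePolynomialWithLeadingProd_of_eqOn hp isOpen_univ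
    Set.univ_nonempty (Set.eqOn_refl _ _)

theorem isPiecewisePolynomialWithLeadingProd_realChromatic (hd : 0 < d)
    (hloop : ∀ e v, ¬ Φ.Step e v v 0) (hloose : ∀ e, Φ.edge e ≠ GainEdge.loose)
    (hH : ∀ i, IsConeMinusFinite (H i)) :
    IsPiecewisePolynomialWithLeadingProd (Φ.realChromatic H) := by
  refine (isContinuousSelection_realChromatic hd hH).isPiecewisePolynomialWithLeadingProd_of_eqOn
    (isContinuousSelection_p hd hloop hloose)
    (U := {y | ∀ i k, (Φ.bound H i k : ℝ) < y (i, k)}) ?_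
    ⟨fun ik => Φ.bound H ik.1 ik.2 + 1, fun i k => lt_add_one _⟩
    fun y hy => realChromatic_eq_p hd hH fun i k => (hy i k).le
  simp only [Set.ofPred_forall]
  exact isOpen_iInter_of_finite fun i => isOpen_iInter_of_finite fun k =>
    isOpen_lt continuous_const (continuous_apply _)

end Piecewise

end GainGraph

theorem theoremT {V E : Type*} [Fintype V] [Fintype E] {d : ℕ} (hd : 0 < d)
    (Φ : GainGraph V E (Fin d → ℤ)) (H : V → Set (Fin d → ℤ))
    (hloop : ∀ e v, ¬ Φ.Step e v v 0)
    (hloose : ∀ e, Φ.edge e ≠ GainEdge.loose)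
    (hH : ∀ i, IsConeMinusFinite (H i)) :
    -- the number of proper colorations is finite for every upper bound
    (∀ m : V → Fin d → ℤ, (Φ.properColorations H m).Finite) ∧
    -- `p` is a piecewise polynomial with leading term the product of all variables
    IsPiecewisePolynomialWithLeadingProd (Φ.p H) ∧
    -- so is the list chromatic function, as the restriction to the integer points of a function
    -- that equals `p` as soon as all variables reach the bound
    (∃ f : (V × Fin d → ℝ) → ℝ,
      IsPiecewisePolynomialWithLeadingProd f ∧
      (∀ m : V → Fin d → ℤ, (Φ.listChromatic H m : ℝ) = f (fun ik => (m ik.1 ik.2 : ℝ))) ∧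
      ∀ y : V × Fin d → ℝ, (∀ i k, (Φ.bound H i k : ℝ) ≤ y (i, k)) → f y = Φ.p H y) ∧
    -- the list chromatic function equals `p` from the bound on
    (∀ m : V → Fin d → ℤ, (∀ i, Φ.bound H i ≤ m i) →
      (Φ.listChromatic H m : ℝ) = Φ.p H (fun ik => (m ik.1 ik.2 : ℝ))) := by
  have hχ := Φ.listChromatic_eq_realChromatic hd hloop hloose hH
  refine ⟨GainGraph.finite_properColorations hH,
    GainGraph.isPiecewisePolynomialWithLeadingProd_p hd hloop hloose,
    ⟨Φ.realChromatic H, GainGraph.isPiecewisePolynomialWithLeadingProd_realChromatic hd hloop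
      hloose hH, hχ, fun y hy => GainGraph.realChromatic_eq_p hd hH hy⟩, fun m hm => ?_⟩
  rw [hχ, GainGraph.realChromatic_eq_p hd hH fun i k => Int.cast_le.2 (hm i k)]
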